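/- Let $(\mathcal V,\otimes,I,\sigma)$ be a braided monoidal category with equalizers and coequalizers, such that $\otimes$ preserves coequalizers in each variable. Let $H=(H,e_H,m_H,\varepsilon_H,\delta_H)$ be a bialgebra in $\mathcal V$ and let $A=(A,e_A,m_A,\alpha_A)$ be a right $H$-comodule algebra, i.e. an algebra in $\mathcal V$ with a right $H$-comodule structure $\alpha_A:A\to A\otimes H$ that is a morphism of algebras, where $A\otimes H$ has product $(m_A\otimes m_H)(A\otimes\sigma_{H,A}\otimes H)$ and unit $e_A\otimes e_H$. (Associativity and unit isomorphisms are suppressed.) Let $i_A:A^H\to A$ be the equalizer of $\alpha_A$ and $A\otimes e_H:A\to A\otimes H$, with the unique algebra structure for which $i_A$ is a morphism of algebras. For a right $A^H$-module $X$ let $X\otimes_{A^H}A$ be the coequalizer of the two actions $X\otimes A^H\otimes A\rightrightarrows X\otimes A$. Let $F_{i_A}:\mathcal V_{A^H}\to\mathcal V_A$, $X\mapsto (X\otimes_{A^H}A,\;X\otimes_{A^H}m_A)$, be the extension-of-scalars functor between the categories of right modules. Let $\mathrm{can}:A\otimes_{A^H}A\to A\otimes H$ be the morphism induced by $(m_A\otimes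 H)(A\otimes\alpha_A):A\otimes A\to A\otimes H$; $A$ is called $H$-Galois if $\mathrm{can}$ is an isomorphism. Let $\mathcal V^H_A$ be the category of right $(A,H)$-modules (relative Hopf modules): objects $X$ with a right $A$-action $\xi_X$ and a right $H$-coaction $\nu_X:X\to X\otimes H$ that is a morphism of right $A$-modules, where $A$ acts on $X\otimes H$ by $(\xi_X\otimes m_H)(X\otimes\sigma_{H,A}\otimes H)(X\otimes H\otimes\alpha_A)$; the morphisms are the morphisms of $\mathcal V$ that respect both the action and the coaction. Put $\lambda=(A\otimes m_H)(\sigma_{H,A}\otimes H)(H\otimes\alpha_A):H\otimes A\to A\otimes H$. Then: 1. $\lambda$ is an entwining structure on the coalgebra $H$ and the algebra $A$, i.e. $$\lambda(H\otimes e_A)=e_A\otimes H,\qquad (A\otimes\varepsilon_H)\lambda=\varepsilon_H\otimes A,$$ $$(A\otimes\delta_H)\lambda=(\lambda\otimes H)(H\otimes\lambda)(\delta_H\otimes A),\qquad \lambda(H\otimes m_A)=(m_A\otimes H)(A\otimes\lambda)(\lambda\otimes A).$$ 2. $\mathcal V^H_A$ coincides with the category of entwined modules for $\lambda$: an object $X$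 with a right $A$-action $\xi_X$ and a right $H$-coaction $\nu_X$ is an $(A,H)$-module if and only if $\nu_X\xi_X=(\xi_X\otimes H)(X\otimes\lambda)(\nu_X\otimes A)$. 3. For every right $A^H$-module $X$ the object $X\otimes_{A^H}A$, with the action $X\otimes_{A^H}m_A$ and the coaction $X\otimes_{A^H}\alpha_A$, is an $(A,H)$-module, and the resulting functor $$\bar F:\mathcal V_{A^H}\to\mathcal V^H_A,\qquad X\mapsto (X\otimes_{A^H}A,\;X\otimes_{A^H}m_A,\;X\otimes_{A^H}\alpha_A)$$ is an equivalence of categories if and only if $F_{i_A}$ is comonadic (i.e. it has a right adjoint and the comparison functor to the coalgebras of the induced comonad on $\mathcal V_A$ is an equivalence) and $A$ is $H$-Galois. -/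

import Mathlib

open CategoryTheory MonoidalCategory Limits
open scoped MonObj ComonObj

universe v u

namespace HopfGalois

section Modules

variable {V : Type u} [Category.{v} V] [MonoidalCategory V]

/-- A right module structure on `X` over the algebra (monoid object) `A`. -/
class RightModObj (A : V) [MonObj A] (X : V) where
  /-- the action -/
  act : X ⊗ A ⟶ X
  act_one : X ◁ η[A] ≫ act = (ρ_ X).hom
  act_mul : X ◁ μ[A] ≫ act = (α_ X A A).inv ≫ act ▷ A ≫ act

/-- A right comodule structure on `X` over the coalgebra (comonoid object) `H`. -/
class RightComodObj (H : V) [ComonObj H] (X : V) where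
  /-- the coaction -/
  coact : X ⟶ X ⊗ H
  coact_counit : coact ≫ X ◁ ε[H] = (ρ_ X).inv
  coact_comul : coact ≫ X ◁ Δ[H] = coact ≫ coact ▷ H ≫ (α_ X H H).hom

/-- The action `X ⊗ A ⟶ X` of a right `A`-module. -/
abbrev act (A X : V) [MonObj A] [RightModObj A X] : X ⊗ A ⟶ X := RightModObj.act

/-- The coaction `X ⟶ X ⊗ H` of a right `H`-comodule. -/
abbrev coact (H X : V) [ComonObj H] [RightComodObj H X] : X ⟶ X ⊗ H := RightComodObj.coact

/-- Right `A`-modules. -/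
structure RightMod (A : V) [MonObj A] where
  /-- the underlying object -/
  X : V
  [mod : RightModObj A X]

attribute [instance] RightMod.mod

/-- Morphisms of right `A`-modules. -/
@[ext]
structure RightMod.Hom {A : V} [MonObj A] (M N : RightMod A) where
  /-- the underlying morphism -/
  hom : M.X ⟶ N.X
  act_hom : act A M.X ≫ hom = hom ▷ A ≫ act A N.X

/-- The category of right `A`-modules. -/
instance (A : V) [MonObj A] : Category (RightMod A) where
  Hom M N := RightMod.Hom M N
  id M := { hom := 𝟙 M.X, act_hom := by simp }
  comp f g :=
    { hom := f.hom ≫ g.hom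
      act_hom := by
        rw [← Category.assoc, f.act_hom, Category.assoc, g.act_hom, comp_whiskerRight,
          Category.assoc] }
  id_comp f := RightMod.Hom.ext (Category.id_comp f.hom)
  comp_id f := RightMod.Hom.ext (Category.comp_id f.hom)
  assoc f g h := RightMod.Hom.ext (Category.assoc f.hom g.hom h.hom)

@[ext]
theorem RightMod.hom_ext {A : V} [MonObj A] {M N : RightMod A} {f g : M ⟶ N}
    (h : f.hom = g.hom) : f = g := RightMod.Hom.ext h

@[simp]
theorem RightMod.id_hom {A : V} [MonObj A] (M : RightMod A) : RightMod.Hom.hom (𝟙 M) = 𝟙 M.X := rfl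

@[simp]
theorem RightMod.comp_hom {A : V} [MonObj A] {M N P : RightMod A} (f : M ⟶ N) (g : N ⟶ P) :
    (f ≫ g).hom = f.hom ≫ g.hom := rfl

/-- Objects with a right `A`-module and a right `H`-comodule structure, with no compatibility
imposed between the two. -/
structure ModComod (A H : V) [MonObj A] [ComonObj H] where
  /-- the underlying object -/
  X : V
  [mod : RightModObj A X]
  [comod : RightComodObj H X]

attribute [instance] ModComod.mod ModComod.comod

/-- Morphisms that are both `A`-module and `H`-comodule morphisms. -/
@[ext]
structure ModComod.Hom {A H : V} [MonObj A] [ComonObj H] (M N : ModComod A H) where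
  /-- the underlying morphism -/
  hom : M.X ⟶ N.X
  act_hom : act A M.X ≫ hom = hom ▷ A ≫ act A N.X
  hom_coact : hom ≫ coact H N.X = coact H M.X ≫ hom ▷ H

/-- The category of objects with a right `A`-module and a right `H`-comodule structure. -/
instance (A H : V) [MonObj A] [ComonObj H] : Category (ModComod A H) where
  Hom M N := ModComod.Hom M N
  id M := { hom := 𝟙 M.X, act_hom := by simp, hom_coact := by simp }
  comp f g :=
    { hom := f.hom ≫ g.hom
      act_hom := by
        rw [← Category.assoc, f.act_hom, Category.assoc, g.act_hom, comp_whiskerRight,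
          Category.assoc]
      hom_coact := by
        rw [Category.assoc, g.hom_coact, ← Category.assoc, f.hom_coact, comp_whiskerRight,
          Category.assoc] }
  id_comp f := ModComod.Hom.ext (Category.id_comp f.hom)
  comp_id f := ModComod.Hom.ext (Category.comp_id f.hom)
  assoc f g h := ModComod.Hom.ext (Category.assoc f.hom g.hom h.hom)

@[ext]
theorem ModComod.hom_ext {A H : V} [MonObj A] [ComonObj H] {M N : ModComod A H} {f g : M ⟶ N}
    (h : f.hom = g.hom) : f = g := ModComod.Hom.ext h

@[simp]
theorem ModComod.id_hom {A H : V} [MonObj A] [ComonObj H] (M : ModComod A H) :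
    ModComod.Hom.hom (𝟙 M) = 𝟙 M.X := rfl

@[simp]
theorem ModComod.comp_hom {A H : V} [MonObj A] [ComonObj H] {M N P : ModComod A H}
    (f : M ⟶ N) (g : N ⟶ P) : (f ≫ g).hom = f.hom ≫ g.hom := rfl

end Modules

section Entwining

variable {V : Type u} [Category.{v} V] [MonoidalCategory V]

/-- `lam : C ⊗ A ⟶ A ⊗ C` is an entwining structure on the coalgebra `C` and the algebra `A`. -/
structure IsEntwining (C A : V) [ComonObj C] [MonObj A] (lam : C ⊗ A ⟶ A ⊗ C) : Prop where
  one : C ◁ η[A] ≫ lam = (ρ_ C).hom ≫ (λ_ C).inv ≫ η[A] ▷ C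
  counit : lam ≫ A ◁ ε[C] ≫ (ρ_ A).hom = ε[C] ▷ A ≫ (λ_ A).hom
  comul : lam ≫ A ◁ Δ[C] =
    Δ[C] ▷ A ≫ (α_ C C A).hom ≫ C ◁ lam ≫ (α_ C A C).inv ≫ lam ▷ C ≫ (α_ A C C).hom
  mul : C ◁ μ[A] ≫ lam =
    (α_ C A A).inv ≫ lam ▷ A ≫ (α_ A C A).hom ≫ A ◁ lam ≫ (α_ A A C).inv ≫ μ[A] ▷ C

/-- The compatibility condition of an entwined module for `lam`: the coaction after the action is
`X ⊗ A ⟶ X ⊗ C ⊗ A ⟶ X ⊗ A ⊗ C ⟶ X ⊗ C` (coaction, then `lam`, then action). -/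
def isEntwinedModule (C A : V) [ComonObj C] [MonObj A] (lam : C ⊗ A ⟶ A ⊗ C) :
    ObjectProperty (ModComod A C) := fun M =>
  act A M.X ≫ coact C M.X =
    coact C M.X ▷ A ≫ (α_ M.X C A).hom ≫ M.X ◁ lam ≫ (α_ M.X A C).inv ≫ act A M.X ▷ C

end Entwining

section RelativeHopf

variable {V : Type u} [Category.{v} V] [MonoidalCategory V] [BraidedCategory V]

/-- The entwining `(A ⊗ m_H)(σ_{H,A} ⊗ H)(H ⊗ α_A) : H ⊗ A ⟶ A ⊗ H` of a comodule algebra. -/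
def comoduleAlgebraEntwining (H A : V) [BimonObj H] [RightComodObj H A] : H ⊗ A ⟶ A ⊗ H :=
  H ◁ coact H A ≫ (α_ H A H).inv ≫ (β_ H A).hom ▷ H ≫ (α_ A H H).hom ≫ A ◁ μ[H]

/-- For a right `A`-module `X` the right action of `A` on `X ⊗ H`:
`A` acts through `A ⟶ A ⊗ H`, with `A` acting on `X` and `H` acting on `H` by multiplication;
in elements `(x ⊗ h) a = x a₀ ⊗ h a₁`. -/
def diagonalAct (H A X : V) [BimonObj H] [MonObj A] [RightComodObj H A] [RightModObj A X] :
    (X ⊗ H) ⊗ A ⟶ X ⊗ H :=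
  (X ⊗ H) ◁ coact H A ≫ tensorμ X H A H ≫ (act A X ⊗ₘ μ[H])

/-- The objects that are `(A, H)`-modules (relative Hopf modules): the coaction `X ⟶ X ⊗ H` is a
morphism of right `A`-modules. -/
def isRelativeHopfModule (H A : V) [BimonObj H] [MonObj A] [RightComodObj H A] :
    ObjectProperty (ModComod A H) := fun M =>
  act A M.X ≫ coact H M.X = coact H M.X ▷ A ≫ diagonalAct H A M.X

/-- The category of relative Hopf modules, i.e. `(A, H)`-modules. -/
abbrev RelativeHopfModule (H A : V) [BimonObj H] [MonObj A] [RightComodObj H A] :=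
  (isRelativeHopfModule H A).FullSubcategory

end RelativeHopf

section ExtensionOfScalars

variable {V : Type u} [Category.{v} V] [MonoidalCategory V]

/-- The left action of `B` on `A` along `i : B ⟶ A`. -/
def leftAct {B A : V} [MonObj A] (i : B ⟶ A) : B ⊗ A ⟶ A := i ▷ A ≫ μ[A]

theorem leftAct_mul {B A : V} [MonObj A] (i : B ⟶ A) :
    leftAct i ▷ A ≫ μ[A] = (α_ B A A).hom ≫ B ◁ μ[A] ≫ leftAct i := by
  simp [leftAct, MonObj.mul_assoc, whisker_exchange_assoc]

/-- The right action of `B` on `A` along `i : B ⟶ A`. -/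
@[reducible]
def rightModOfHom {B A : V} [MonObj B] [MonObj A] (i : B ⟶ A) [IsMonHom i] : RightModObj B A where
  act := A ◁ i ≫ μ[A]
  act_one := by
    rw [← Category.assoc, ← whiskerLeft_comp, IsMonHom.one_hom, MonObj.mul_one]
  act_mul := by
    rw [← Category.assoc, ← whiskerLeft_comp, IsMonHom.mul_hom, MonoidalCategory.tensorHom_def]
    simp only [MonoidalCategory.whiskerLeft_comp, Category.assoc, comp_whiskerRight]
    rw [← associator_inv_naturality_middle_assoc, ← whisker_exchange_assoc, MonObj.mul_assoc]
    simp

/-- `A` as a right `B`-module along `i : B ⟶ A`. -/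
def RightMod.ofHom {B A : V} [MonObj B] [MonObj A] (i : B ⟶ A) [IsMonHom i] : RightMod B :=
  letI := rightModOfHom i
  { X := A }

variable [HasCoequalizers V]

/-- The tensor product `X ⊗_B A` of a right `B`-module `X` with `A`, a left `B`-module
along `i : B ⟶ A`: the coequalizer of the two actions `(X ⊗ B) ⊗ A ⇉ X ⊗ A`. -/
noncomputable def tensorOver {B A : V} [MonObj B] [MonObj A] (i : B ⟶ A) (M : RightMod B) : V :=
  coequalizer (act B M.X ▷ A) ((α_ M.X B A).hom ≫ M.X ◁ leftAct i)

/-- The projection `X ⊗ A ⟶ X ⊗_B A`. -/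
noncomputable def tensorOver.π {B A : V} [MonObj B] [MonObj A] (i : B ⟶ A) (M : RightMod B) :
    M.X ⊗ A ⟶ tensorOver i M :=
  coequalizer.π _ _

theorem tensorOver.condition {B A : V} [MonObj B] [MonObj A] (i : B ⟶ A) (M : RightMod B) :
    act B M.X ▷ A ≫ tensorOver.π i M = (α_ M.X B A).hom ≫ M.X ◁ leftAct i ≫ tensorOver.π i M := by
  have h := coequalizer.condition (act B M.X ▷ A) ((α_ M.X B A).hom ≫ M.X ◁ leftAct i)
  rw [Category.assoc] at h
  exact h

theorem tensorOver.condition_assoc {B A : V} [MonObj B] [MonObj A] (i : B ⟶ A) (M : RightMod B)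
    {Z : V} (g : tensorOver i M ⟶ Z) :
    act B M.X ▷ A ≫ tensorOver.π i M ≫ g =
      (α_ M.X B A).hom ≫ M.X ◁ leftAct i ≫ tensorOver.π i M ≫ g := by
  rw [← Category.assoc, tensorOver.condition]
  simp only [Category.assoc]

instance {B A : V} [MonObj B] [MonObj A] (i : B ⟶ A) (M : RightMod B) :
    Epi (tensorOver.π i M) :=
  inferInstanceAs (Epi (coequalizer.π _ _))

/-- The morphism `X ⊗_B A ⟶ Z` induced by a `B`-balanced morphism `X ⊗ A ⟶ Z`. -/
noncomputable def tensorOver.desc {B A : V} [MonObj B] [MonObj A] (i : B ⟶ A) (M : RightMod B)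
    {Z : V} (f : M.X ⊗ A ⟶ Z)
    (hf : act B M.X ▷ A ≫ f = (α_ M.X B A).hom ≫ M.X ◁ leftAct i ≫ f) : tensorOver i M ⟶ Z :=
  coequalizer.desc f (by simpa using hf)

theorem tensorOver.π_desc {B A : V} [MonObj B] [MonObj A] (i : B ⟶ A) (M : RightMod B)
    {Z : V} (f : M.X ⊗ A ⟶ Z)
    (hf : act B M.X ▷ A ≫ f = (α_ M.X B A).hom ≫ M.X ◁ leftAct i ≫ f) :
    tensorOver.π i M ≫ tensorOver.desc i M f hf = f :=
  coequalizer.π_desc _ _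

theorem tensorOver.π_desc_assoc {B A : V} [MonObj B] [MonObj A] (i : B ⟶ A) (M : RightMod B)
    {Z W : V} (f : M.X ⊗ A ⟶ Z)
    (hf : act B M.X ▷ A ≫ f = (α_ M.X B A).hom ≫ M.X ◁ leftAct i ≫ f) (g : Z ⟶ W) :
    tensorOver.π i M ≫ tensorOver.desc i M f hf ≫ g = f ≫ g := by
  rw [← Category.assoc, tensorOver.π_desc]

/-- Functoriality of `X ⊗_B A` in `X`. -/
noncomputable def tensorOver.map {B A : V} [MonObj B] [MonObj A] (i : B ⟶ A) {M N : RightMod B}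
    (f : M ⟶ N) : tensorOver i M ⟶ tensorOver i N :=
  tensorOver.desc i M (f.hom ▷ A ≫ tensorOver.π i N) (by
    rw [← comp_whiskerRight_assoc, f.act_hom, comp_whiskerRight_assoc, tensorOver.condition]
    simp [whisker_exchange_assoc])

theorem tensorOver.π_map {B A : V} [MonObj B] [MonObj A] (i : B ⟶ A) {M N : RightMod B}
    (f : M ⟶ N) : tensorOver.π i M ≫ tensorOver.map i f = f.hom ▷ A ≫ tensorOver.π i N :=
  tensorOver.π_desc _ _ _ _

theorem tensorOver.balanced {B A : V} [MonObj B] [MonObj A] (i : B ⟶ A) (M : RightMod B) :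
    act B M.X ▷ A ▷ A ≫ (α_ M.X A A).hom ≫ M.X ◁ μ[A] ≫ tensorOver.π i M =
      ((α_ M.X B A).hom ≫ M.X ◁ leftAct i) ▷ A ≫
        (α_ M.X A A).hom ≫ M.X ◁ μ[A] ≫ tensorOver.π i M := by
  rw [associator_naturality_left_assoc, ← whisker_exchange_assoc, tensorOver.condition,
    comp_whiskerRight_assoc, associator_naturality_middle_assoc,
    ← whiskerLeft_comp_assoc _ (leftAct i ▷ A), leftAct_mul]
  simp

variable [∀ X : V, PreservesColimitsOfShape WalkingParallelPair (tensorRight X)]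

instance {B A : V} [MonObj B] [MonObj A] (i : B ⟶ A) (M : RightMod B) (Z : V) :
    Epi (tensorOver.π i M ▷ Z) :=
  inferInstanceAs (Epi ((tensorRight Z).map (coequalizer.π _ _)))

/-- The right `A`-action `X ⊗_B m_A` on `X ⊗_B A`. -/
noncomputable def tensorOver.rightAct {B A : V} [MonObj B] [MonObj A] (i : B ⟶ A) (M : RightMod B) :
    tensorOver i M ⊗ A ⟶ tensorOver i M :=
  (isColimitOfHasCoequalizerOfPreservesColimit (tensorRight A) (act B M.X ▷ A)
    ((α_ M.X B A).hom ≫ M.X ◁ leftAct i)).desc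
      (Cofork.ofπ ((α_ M.X A A).hom ≫ M.X ◁ μ[A] ≫ tensorOver.π i M) (by
        simpa using tensorOver.balanced i M))

theorem tensorOver.π_rightAct {B A : V} [MonObj B] [MonObj A] (i : B ⟶ A) (M : RightMod B) :
    tensorOver.π i M ▷ A ≫ tensorOver.rightAct i M =
      (α_ M.X A A).hom ≫ M.X ◁ μ[A] ≫ tensorOver.π i M :=
  (isColimitOfHasCoequalizerOfPreservesColimit (tensorRight A) (act B M.X ▷ A)
    ((α_ M.X B A).hom ≫ M.X ◁ leftAct i)).fac _ WalkingParallelPair.one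

noncomputable instance {B A : V} [MonObj B] [MonObj A] (i : B ⟶ A) (M : RightMod B) :
    RightModObj A (tensorOver i M) where
  act := tensorOver.rightAct i M
  act_one := by
    rw [← cancel_epi (tensorOver.π i M ▷ _), ← whisker_exchange_assoc, tensorOver.π_rightAct]
    rw [tensor_whiskerLeft]
    simp only [Category.assoc, Iso.inv_hom_id_assoc]
    rw [← whiskerLeft_comp_assoc, MonObj.mul_one]
    simp
  act_mul := by
    rw [← cancel_epi (tensorOver.π i M ▷ _), ← whisker_exchange_assoc, tensorOver.π_rightAct]
    rw [associator_inv_naturality_left_assoc]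
    rw [← comp_whiskerRight_assoc, tensorOver.π_rightAct]
    simp only [comp_whiskerRight, Category.assoc, tensorOver.π_rightAct]
    simp only [tensor_whiskerLeft, Category.assoc, Iso.inv_hom_id_assoc]
    rw [← whiskerLeft_comp_assoc, MonObj.mul_assoc_flip]
    simp [-MonObj.mul_assoc]

/-- The extension-of-scalars functor `X ↦ (X ⊗_B A, X ⊗_B m_A)` along a morphism of algebras
`i : B ⟶ A`. (That `i` preserves units and products is not needed for the construction.) -/
noncomputable def extensionOfScalars {B A : V} [MonObj B] [MonObj A] (i : B ⟶ A) :
    RightMod B ⥤ RightMod A where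
  obj M := { X := tensorOver i M }
  map {M N} f :=
    { hom := tensorOver.map i f
      act_hom := by
        rw [← cancel_epi (tensorOver.π i M ▷ _)]
        dsimp only [act, RightModObj.act]
        rw [← Category.assoc, tensorOver.π_rightAct]
        simp only [Category.assoc, tensorOver.π_map]
        rw [← comp_whiskerRight_assoc, tensorOver.π_map, comp_whiskerRight_assoc,
          tensorOver.π_rightAct, whisker_exchange_assoc, associator_naturality_left_assoc] }
  map_id M := by
    ext
    refine (cancel_epi (tensorOver.π i M)).1 ?_
    exact (tensorOver.π_map i (𝟙 M)).trans (by simp)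
  map_comp f g := by
    ext
    refine (cancel_epi (tensorOver.π i _)).1 ?_
    simp only [RightMod.comp_hom]
    rw [← Category.assoc, tensorOver.π_map, tensorOver.π_map, Category.assoc, tensorOver.π_map]
    simp

end ExtensionOfScalars

section ComoduleAlgebra

variable {V : Type u} [Category.{v} V] [MonoidalCategory V] [BraidedCategory V]
variable (H A : V) [BimonObj H] [MonObj A] [RightComodObj H A]

/-- `A` is a right `H`-comodule algebra: the coaction `A ⟶ A ⊗ H` is a morphism of algebras, for
the tensor product algebra structure on `A ⊗ H`. -/
abbrev IsRightComoduleAlgebra : Prop := IsMonHom (coact H A)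

variable [IsRightComoduleAlgebra H A]

theorem coact_mul : μ[A] ≫ coact H A =
    (coact H A ⊗ₘ coact H A) ≫ tensorμ A H A H ≫ (μ[A] ⊗ₘ μ[H]) :=
  IsMonHom.mul_hom (coact H A)

theorem coact_one : η[A] ≫ coact H A = (λ_ (𝟙_ V)).inv ≫ (η[A] ⊗ₘ η[H]) :=
  IsMonHom.one_hom (coact H A)

theorem coact_one_eq : η[A] ≫ coact H A = η[A] ≫ (ρ_ A).inv ≫ A ◁ η[H] := by
  rw [coact_one, MonoidalCategory.tensorHom_def]
  simp [unitors_inv_equal]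

end ComoduleAlgebra

section Coinvariants

theorem unit_tensorμ {V : Type u} [Category.{v} V] [MonoidalCategory V] [BraidedCategory V]
    (X A H : V) [MonObj H] {Y : V} (f : X ⊗ A ⟶ Y) :
    ((ρ_ X).inv ≫ X ◁ η[H]) ▷ (A ⊗ H) ≫ tensorμ X H A H ≫ (f ⊗ₘ μ[H]) =
      (α_ X A H).inv ≫ f ▷ H := by
  rw [comp_whiskerRight_assoc, ← id_tensorHom X η[H], tensorμ_natural_left_assoc,
    tensorHom_comp_tensorHom, MonObj.one_mul, id_whiskerRight, Category.id_comp,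
    ← Category.comp_id f, ← Category.id_comp (λ_ H).hom, ← tensorHom_comp_tensorHom]
  simp only [tensorμ, braiding_tensorUnit_left, Category.assoc, Category.comp_id,
    MonoidalCategory.tensorHom_def', ← MonoidalCategory.whiskerLeft_comp_assoc]
  rw [whisker_exchange]
  monoidal

variable {V : Type u} [Category.{v} V] [MonoidalCategory V] [BraidedCategory V] [HasEqualizers V]

/-- The coinvariants `X^H` of a right `H`-comodule `X`: the equalizer of the coaction and
`X ⊗ e_H`. -/
noncomputable def coinvariants (H X : V) [BimonObj H] [RightComodObj H X] : V :=
  equalizer (coact H X) ((ρ_ X).inv ≫ X ◁ η[H])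

/-- The inclusion `i_X : X^H ⟶ X`. -/
noncomputable def coinvariants.ι (H X : V) [BimonObj H] [RightComodObj H X] :
    coinvariants H X ⟶ X :=
  equalizer.ι _ _

instance (H X : V) [BimonObj H] [RightComodObj H X] : Mono (coinvariants.ι H X) :=
  inferInstanceAs (Mono (equalizer.ι _ _))

theorem coinvariants.condition (H X : V) [BimonObj H] [RightComodObj H X] :
    coinvariants.ι H X ≫ coact H X = coinvariants.ι H X ≫ (ρ_ X).inv ≫ X ◁ η[H] :=
  equalizer.condition _ _

/-- The universal property of the coinvariants. -/
noncomputable def coinvariants.lift (H X : V) [BimonObj H] [RightComodObj H X] {Z : V} (f : Z ⟶ X)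
    (hf : f ≫ coact H X = f ≫ (ρ_ X).inv ≫ X ◁ η[H]) : Z ⟶ coinvariants H X :=
  equalizer.lift f hf

theorem coinvariants.lift_ι (H X : V) [BimonObj H] [RightComodObj H X] {Z : V} (f : Z ⟶ X)
    (hf : f ≫ coact H X = f ≫ (ρ_ X).inv ≫ X ◁ η[H]) :
    coinvariants.lift H X f hf ≫ coinvariants.ι H X = f :=
  equalizer.lift_ι _ _

variable (H A : V) [BimonObj H] [MonObj A] [RightComodObj H A]

variable [IsRightComoduleAlgebra H A]

/-- The coaction of `A` is left `A^H`-linear. -/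
theorem leftAct_coact : leftAct (coinvariants.ι H A) ≫ coact H A =
    coinvariants H A ◁ coact H A ≫ (α_ _ A H).inv ≫ leftAct (coinvariants.ι H A) ▷ H := by
  have h := coinvariants.condition H A
  rw [leftAct, Category.assoc, coact_mul, ← tensorHom_id, tensorHom_comp_tensorHom_assoc, h]
  rw [Category.id_comp, MonoidalCategory.tensorHom_def', Category.assoc, comp_whiskerRight,
    Category.assoc, unit_tensorμ]
  simp

theorem coinvariants_mul :
    ((coinvariants.ι H A ⊗ₘ coinvariants.ι H A) ≫ μ[A]) ≫ coact H A =
      ((coinvariants.ι H A ⊗ₘ coinvariants.ι H A) ≫ μ[A]) ≫ (ρ_ A).inv ≫ A ◁ η[H] := by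
  have h : (coinvariants.ι H A ⊗ₘ coinvariants.ι H A) ≫ μ[A] =
      coinvariants H A ◁ coinvariants.ι H A ≫ leftAct (coinvariants.ι H A) := by
    rw [leftAct, MonoidalCategory.tensorHom_def', Category.assoc]
  rw [h, Category.assoc, leftAct_coact, ← whiskerLeft_comp_assoc, coinvariants.condition]
  simp only [MonoidalCategory.whiskerLeft_comp, Category.assoc]
  rw [associator_inv_naturality_right_assoc, whisker_exchange]
  simp

/-- The algebra structure on `A^H` for which `i_A` is a morphism of algebras. -/
noncomputable instance : MonObj (coinvariants H A) where
  one := coinvariants.lift H A η[A] (coact_one_eq H A)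
  mul := coinvariants.lift H A _ (coinvariants_mul H A)
  one_mul := by
    rw [← cancel_mono (coinvariants.ι H A), Category.assoc, coinvariants.lift_ι,
      MonoidalCategory.tensorHom_def, Category.assoc, ← comp_whiskerRight_assoc,
      coinvariants.lift_ι, ← whisker_exchange_assoc]
    simp
  mul_one := by
    rw [← cancel_mono (coinvariants.ι H A), Category.assoc, coinvariants.lift_ι,
      MonoidalCategory.tensorHom_def', Category.assoc, ← whiskerLeft_comp_assoc,
      coinvariants.lift_ι, whisker_exchange_assoc]
    simp
  mul_assoc := by
    rw [← cancel_mono (coinvariants.ι H A)]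
    simp only [Category.assoc, coinvariants.lift_ι]
    rw [whiskerRight_comp_tensorHom_assoc, whiskerLeft_comp_tensorHom_assoc,
      coinvariants.lift_ι, ← tensorHom_comp_whiskerLeft, ← tensorHom_comp_whiskerRight,
      Category.assoc, MonObj.mul_assoc, associator_naturality_assoc, Category.assoc]

instance : IsMonHom (coinvariants.ι H A) where
  one_hom := coinvariants.lift_ι _ _ _ _
  mul_hom := coinvariants.lift_ι _ _ _ _

theorem can_balanced :
    (A ◁ coinvariants.ι H A ≫ μ[A]) ▷ A ≫ A ◁ coact H A ≫ (α_ A A H).inv ≫ μ[A] ▷ H =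
      (α_ A (coinvariants H A) A).hom ≫ A ◁ leftAct (coinvariants.ι H A) ≫
        A ◁ coact H A ≫ (α_ A A H).inv ≫ μ[A] ▷ H := by
  rw [← whiskerLeft_comp_assoc, leftAct_coact]
  have h : (A ◁ coinvariants.ι H A ≫ μ[A]) ▷ A ≫ μ[A] =
      (α_ A (coinvariants H A) A).hom ≫ A ◁ leftAct (coinvariants.ι H A) ≫ μ[A] := by
    simp [leftAct]
  rw [← whisker_exchange_assoc, associator_inv_naturality_left_assoc, ← comp_whiskerRight, h]
  simp

end Coinvariants

section Galois

variable {V : Type u} [Category.{v} V] [MonoidalCategory V] [BraidedCategory V] [HasEqualizers V]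
  [HasCoequalizers V]
variable (H A : V) [BimonObj H] [MonObj A] [RightComodObj H A] [IsRightComoduleAlgebra H A]

/-- The canonical morphism `can : A ⊗_{A^H} A ⟶ A ⊗ H`, induced by
`(m_A ⊗ H)(A ⊗ α_A) : A ⊗ A ⟶ A ⊗ H`; in elements `a ⊗ b ↦ a b₀ ⊗ b₁`. -/
noncomputable def can :
    tensorOver (coinvariants.ι H A) (RightMod.ofHom (coinvariants.ι H A)) ⟶ A ⊗ H :=
  tensorOver.desc _ _ (A ◁ coact H A ≫ (α_ A A H).inv ≫ μ[A] ▷ H) (can_balanced H A)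

/-- `A` is `H`-Galois: the canonical morphism is an isomorphism. -/
def IsHopfGalois : Prop := IsIso (can H A)

/-- The coaction `X ⊗_{A^H} α_A` on `X ⊗_{A^H} A`. -/
noncomputable def tensorOver.coaction (M : RightMod (coinvariants H A)) :
    tensorOver (coinvariants.ι H A) M ⟶ tensorOver (coinvariants.ι H A) M ⊗ H :=
  tensorOver.desc _ M
    (M.X ◁ coact H A ≫ (α_ M.X A H).inv ≫ tensorOver.π (coinvariants.ι H A) M ▷ H) (by
    rw [← whiskerLeft_comp_assoc, leftAct_coact, ← whisker_exchange_assoc,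
      associator_inv_naturality_left_assoc, ← comp_whiskerRight, tensorOver.condition]
    simp)

theorem tensorOver.π_coaction (M : RightMod (coinvariants H A)) :
    tensorOver.π (coinvariants.ι H A) M ≫ tensorOver.coaction H A M =
      M.X ◁ coact H A ≫ (α_ M.X A H).inv ≫ tensorOver.π (coinvariants.ι H A) M ▷ H :=
  tensorOver.π_desc _ _ _ _

noncomputable instance (M : RightMod (coinvariants H A)) :
    RightComodObj H (tensorOver (coinvariants.ι H A) M) where
  coact := tensorOver.coaction H A M
  coact_counit := by
    rw [← cancel_epi (tensorOver.π _ M), ← Category.assoc, tensorOver.π_coaction]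
    have h := RightComodObj.coact_counit (H := H) (X := A)
    simp only [Category.assoc]
    rw [← whisker_exchange, ← associator_inv_naturality_right_assoc, ← whiskerLeft_comp_assoc, h]
    simp
  coact_comul := by
    rw [← cancel_epi (tensorOver.π _ M), ← Category.assoc, tensorOver.π_coaction,
      ← Category.assoc (tensorOver.π _ M), tensorOver.π_coaction]
    have h := RightComodObj.coact_comul (H := H) (X := A)
    simp only [Category.assoc]
    rw [← whisker_exchange, ← associator_inv_naturality_right_assoc, ← whiskerLeft_comp_assoc, h,
      ← comp_whiskerRight_assoc, tensorOver.π_coaction]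
    simp

variable [∀ X : V, PreservesColimitsOfShape WalkingParallelPair (tensorRight X)]

/-- The functor `X ↦ (X ⊗_{A^H} A, X ⊗_{A^H} m_A, X ⊗_{A^H} α_A)` from right `A^H`-modules to
objects with a right `A`-module and a right `H`-comodule structure. -/
noncomputable def inducedModComod : RightMod (coinvariants H A) ⥤ ModComod A H where
  obj M := { X := tensorOver (coinvariants.ι H A) M }
  map {M N} f :=
    { hom := tensorOver.map (coinvariants.ι H A) f
      act_hom := ((extensionOfScalars (coinvariants.ι H A)).map f).act_hom
      hom_coact := by
        refine (cancel_epi (tensorOver.π _ M)).1 ?_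
        dsimp only [coact, RightComodObj.coact]
        rw [← Category.assoc, tensorOver.π_map, Category.assoc, tensorOver.π_coaction,
          ← Category.assoc (tensorOver.π _ M), tensorOver.π_coaction]
        simp only [Category.assoc]
        rw [← comp_whiskerRight, tensorOver.π_map, ← whisker_exchange_assoc]
        simp }
  map_id M := by
    ext
    exact congrArg RightMod.Hom.hom ((extensionOfScalars (coinvariants.ι H A)).map_id M)
  map_comp f g := by
    ext
    exact congrArg RightMod.Hom.hom ((extensionOfScalars (coinvariants.ι H A)).map_comp f g)

end Galois

end HopfGalois

/-! Write B for the algebra of coinvariants. The comparison with entwined modules reduces the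
theorem to adjunctions over the category of right A-modules. For any entwining, the functor U
forgetting the coaction has right adjoint N ↦ N ⊗ H and is comonadic: a coalgebra for the induced
comonad is exactly an A-module with an A-linear H-coaction, that is, an entwined module
(`IsEntwining.comparison_isEquivalence`).

Composing the induced functor L from B-modules with U gives extension of scalars, which is left
adjoint to restriction R along the inclusion. Transposing the counit of that adjunction under U ⊣ G
yields the mate R ⋙ L ⟶ G, a morphism of comonads after applying U. Its component at N is the
canonical morphism N ⊗_B A ⟶ N ⊗ H. The comparison functor of L ⋙ U followed by the functor on
coalgebras given by the mate is isomorphic to L followed by the comparison functor of U. If the mate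
is invertible, L is therefore an equivalence exactly when L ⋙ U is comonadic; and if L is an
equivalence, the mate is automatically invertible (`isIso_mate`).

It remains to see that invertibility at N = A, the Galois condition, implies invertibility at every
N (`isIso_canMod`): the morphism h ↦ can⁻¹(1 ⊗ h) provides an explicit inverse n ⊗ h ↦ n · can⁻¹(1 ⊗
h). -/

namespace HopfGalois

/-! ### Functors over a comonadic functor: mates and comparison functors. -/

section ComonadComparison

variable {D : Type*} [Category* D]

/-- A morphism of comonads induces a functor between the categories of coalgebras. -/
def coalgebraFunctor {K T : Comonad D} (φ : K ⟶ T) : K.Coalgebra ⥤ T.Coalgebra where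
  obj X :=
    { A := X.A
      a := X.a ≫ φ.app X.A
      counit := by rw [Category.assoc, ComonadHom.app_ε, X.counit]
      coassoc := by
        rw [Category.assoc, ComonadHom.app_δ, X.coassoc_assoc, T.map_comp]
        simp only [Category.assoc]
        rw [← φ.naturality_assoc X.a] }
  map f :=
    { f := f.f
      h := by
        refine (Category.assoc _ _ _).trans ?_
        rw [← φ.naturality f.f]
        exact f.h_assoc _ }

/-- A T-coalgebra structure becomes a K-coalgebra structure on the same object by composing with the
inverse of φ, so only the axioms need checking. -/
theorem coalgebraFunctor_isEquivalence {K T : Comonad D} (φ : K ⟶ T)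
    [∀ X, IsIso (φ.app X)] : (coalgebraFunctor φ).IsEquivalence where
  faithful := ⟨fun {X Y f g} h => by
    ext
    exact congrArg (fun g => g.f) h⟩
  full := ⟨fun {X Y} g => ⟨
    { f := g.f
      h := by
        rw [← cancel_mono (φ.app Y.A), Category.assoc]
        refine (X.a ≫= φ.naturality (X := X.A) (Y := Y.A) g.f).trans ?_
        exact (Category.assoc _ _ _).symm.trans (g.h.trans (Category.assoc _ _ _).symm) }, rfl⟩⟩
  essSurj := ⟨fun Y => ⟨
    { A := Y.A
      a := Y.a ≫ inv (φ.app Y.A)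
      counit := by
        rw [Category.assoc, ← ComonadHom.app_ε φ, IsIso.inv_hom_id_assoc, Y.counit]
      coassoc := by
        have h := ComonadHom.app_δ φ Y.A
        have e : (Y.a ≫ inv (φ.app Y.A)) ≫ φ.app Y.A = Y.a := by simp
        -- After composing with these two isomorphisms, compatibility of φ with comultiplication
        -- turns the claim into coassociativity of Y.
        rw [← cancel_mono (φ.app (K.obj Y.A)), ← cancel_mono (T.map (φ.app Y.A))]
        simp only [Category.assoc]
        rw [← h, IsIso.inv_hom_id_assoc, Y.coassoc, φ.naturality_assoc,
          IsIso.inv_hom_id_assoc, ← T.map_comp, Category.assoc, IsIso.inv_hom_id,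
          Category.comp_id] },
    ⟨Comonad.Coalgebra.isoMk (Iso.refl _) (by
      change ((Y.a ≫ inv (φ.app Y.A)) ≫ φ.app Y.A) ≫ T.map (𝟙 Y.A) = 𝟙 Y.A ≫ Y.a
      rw [T.map_id]
      simp)⟩⟩⟩

variable {C E : Type*} [Category* C] [Category* E] {L : C ⥤ E} {U : E ⥤ D} {G R : D ⥤ _}
  (adj : L ⋙ U ⊣ R) (adj' : U ⊣ G)

/-- For adjunctions `L ⋙ U ⊣ R` and `U ⊣ G`, the mate `R ⋙ L ⟶ G` of the counit of the first. -/
def mate (N : D) : L.obj (R.obj N) ⟶ G.obj N :=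
  adj'.homEquiv _ _ (adj.counit.app N)

theorem map_mate_counit (N : D) :
    U.map (mate adj adj' N) ≫ adj'.counit.app N = adj.counit.app N :=
  (adj'.homEquiv_counit ..).symm.trans (Equiv.symm_apply_apply _ _)

/-- Composition with the mate realises the bijection Hom(X, RN) ≅ Hom(ULX, N) ≅ Hom(LX, GN) on
morphisms in the image of L. -/
theorem comp_mate_eq {X : C} {N : D} (y : X ⟶ R.obj N) :
    L.map y ≫ mate adj adj' N = adj'.homEquiv _ _ ((adj.homEquiv _ _).symm y) := by
  rw [mate, ← adj'.homEquiv_naturality_left]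
  exact congrArg _ (adj.homEquiv_counit ..).symm

/-- Both sides are transposes of the identity of U L X. This one identity gives compatibility with
comultiplication and with the comparison functors. -/
theorem unit_mate (X : C) :
    L.map (adj.unit.app X) ≫ mate adj adj' (U.obj (L.obj X)) = adj'.unit.app (L.obj X) := by
  refine (comp_mate_eq adj adj' _).trans ?_
  rw [← adj'.homEquiv_id, ← adj.homEquiv_id]
  exact congrArg _ (Equiv.symm_apply_apply _ _)

theorem mate_naturality {N N' : D} (f : N ⟶ N') :
    L.map (R.map f) ≫ mate adj adj' N' = mate adj adj' N ≫ G.map f := by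
  rw [mate, mate, ← adj'.homEquiv_naturality_left, ← adj'.homEquiv_naturality_right]
  congr 1
  exact adj.counit.naturality f

/-- The mate as a morphism of comonads. -/
def mateHom : adj.toComonad ⟶ adj'.toComonad where
  app N := U.map (mate adj adj' N)
  naturality N N' f := by
    refine (U.map_comp _ _).symm.trans ((congrArg U.map (mate_naturality adj adj' f)).trans ?_)
    exact U.map_comp _ _
  app_ε N := map_mate_counit adj adj' N
  app_δ N := by
    change U.map _ ≫ U.map (adj'.unit.app (G.obj N)) =
      U.map (L.map (adj.unit.app (R.obj N))) ≫ U.map (mate adj adj' (U.obj (L.obj (R.obj N)))) ≫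
        U.map (G.map (U.map (mate adj adj' N)))
    rw [← U.map_comp, ← U.map_comp, ← U.map_comp]
    congr 1
    rw [← Category.assoc, unit_mate]
    exact adj'.unit.naturality (mate adj adj' N)

/-- The comparison functors are intertwined by the mate. -/
def comparisonIso : Comonad.comparison adj ⋙ coalgebraFunctor (mateHom adj adj') ≅
    L ⋙ Comonad.comparison adj' :=
  NatIso.ofComponents (fun X => Comonad.Coalgebra.isoMk (Iso.refl _) (by
    change (U.map (L.map (adj.unit.app X)) ≫ U.map (mate adj adj' (U.obj (L.obj X)))) ≫
      U.map (G.map (𝟙 _)) = 𝟙 _ ≫ U.map (adj'.unit.app (L.obj X))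
    rw [← U.map_comp, unit_mate]
    simp)) (fun f => by
    ext
    exact (Category.comp_id _).trans (Category.id_comp _).symm)

/-- Since y ↦ L y ≫ mate is bijective, essential surjectivity of L yields a section of the mate, and
fullness shows that it is a two-sided inverse. -/
theorem isIso_mate [L.IsEquivalence] (N : D) : IsIso (mate adj adj' N) := by
  let e := L.objObjPreimageIso (G.obj N)
  let y := adj.homEquiv _ _ ((adj'.homEquiv _ _).symm e.hom)
  have hy : L.map y ≫ mate adj adj' N = e.hom := by
    erw [comp_mate_eq adj adj']
    rw [Equiv.symm_apply_apply]
    exact Equiv.apply_symm_apply _ _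
  have hs : (e.inv ≫ L.map y) ≫ mate adj adj' N = 𝟙 _ := by
    rw [Category.assoc, hy, e.inv_hom_id]
  refine ⟨e.inv ≫ L.map y, ?_, hs⟩
  -- The other composite is L z by fullness; z and the identity agree after L and the mate, hence
  -- coincide by the bijection.
  obtain ⟨z, hz⟩ := L.map_surjective (mate adj adj' N ≫ e.inv ≫ L.map y)
  rw [← hz]
  have h : L.map z ≫ mate adj adj' N = L.map (𝟙 _) ≫ mate adj adj' N := by
    rw [hz, Category.assoc, hs, L.map_id, Category.comp_id, Category.id_comp]
  rw [comp_mate_eq, comp_mate_eq] at h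
  rw [(adj.homEquiv _ _).symm.injective ((adj'.homEquiv _ _).injective h), L.map_id]

/-- If `U ⊣ G` is comonadic, a functor `L` for which `L ⋙ U` has a right adjoint is an equivalence
if and only if `L ⋙ U` is comonadic and the mate of its counit is invertible. -/
theorem isEquivalence_iff_comparison [(Comonad.comparison adj').IsEquivalence] :
    L.IsEquivalence ↔
      (Comonad.comparison adj).IsEquivalence ∧ ∀ N, IsIso (mate adj adj' N) := by
  constructor
  · intro _
    have hm := isIso_mate adj adj'
    have (N : D) : IsIso ((mateHom adj adj').app N) := inferInstanceAs (IsIso (U.map _))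
    have := coalgebraFunctor_isEquivalence (mateHom adj adj')
    have := Functor.isEquivalence_of_iso (comparisonIso adj adj').symm
    exact ⟨Functor.isEquivalence_of_comp_right _ (coalgebraFunctor (mateHom adj adj')), hm⟩
  · rintro ⟨_, hm⟩
    have (N : D) : IsIso ((mateHom adj adj').app N) := inferInstanceAs (IsIso (U.map _))
    have := coalgebraFunctor_isEquivalence (mateHom adj adj')
    have := Functor.isEquivalence_of_iso (comparisonIso adj adj')
    exact Functor.isEquivalence_of_comp_right _ (Comonad.comparison adj')

end ComonadComparison

/-! ### Comonadicity relative to a given right adjoint. -/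

section Comonadic

variable {C D : Type*} [Category.{v} C] [Category.{v} D]

/-- Comonadicity does not depend on the choice of the right adjoint. -/
theorem nonempty_comonadicLeftAdjoint_iff {F : C ⥤ D} {R : D ⥤ C} (adj : F ⊣ R) :
    Nonempty (ComonadicLeftAdjoint F) ↔ (Comonad.comparison adj).IsEquivalence := by
  refine ⟨fun ⟨_⟩ => ?_, fun h => ⟨⟨R, adj, h⟩⟩⟩
  -- Creating equalizers of F-cosplit pairs does not mention the right adjoint, so Beck's theorem
  -- can be applied to `adj` instead of the chosen adjunction.
  have : Comonad.CreatesLimitOfIsCosplitPair F :=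
    ⟨fun f g _ => Comonad.createsFSplitEqualizersOfComonadic f g⟩
  exact (Comonad.comonadicOfCreatesFSplitEqualizers adj).eqv

end Comonadic

/-! ### The entwining of a comodule algebra, λ(h ⊗ a) = a₀ ⊗ h a₁ in elements. -/

section Entwining

variable {V : Type u} [Category.{v} V] [MonoidalCategory V] [BraidedCategory V]

theorem diagonalAct_eq (H A X : V) [BimonObj H] [MonObj A] [RightComodObj H A] [RightModObj A X] :
    diagonalAct H A X = (α_ X H A).hom ≫ X ◁ comoduleAlgebraEntwining H A ≫ (α_ X A H).inv ≫
      act A X ▷ H := by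
  simp only [diagonalAct, comoduleAlgebraEntwining, tensorμ, MonoidalCategory.tensorHom_def',
    Category.assoc, MonoidalCategory.whiskerLeft_comp, tensor_whiskerLeft,
    Iso.inv_hom_id_assoc]

theorem isRelativeHopfModule_eq (H A : V) [BimonObj H] [MonObj A] [RightComodObj H A] :
    isRelativeHopfModule H A = isEntwinedModule H A (comoduleAlgebraEntwining H A) := by
  funext M
  simp only [isRelativeHopfModule, isEntwinedModule, diagonalAct_eq]

variable (H A : V) [BimonObj H] [RightComodObj H A]

theorem entwining_counit :
    comoduleAlgebraEntwining H A ≫ A ◁ ε[H] ≫ (ρ_ A).hom = ε[H] ▷ A ≫ (λ_ A).hom := by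
  have h : coact H A ≫ A ◁ ε[H] = (ρ_ A).inv := RightComodObj.coact_counit
  calc
    _ = 𝟙 _ ⊗≫ H ◁ coact H A ⊗≫ (β_ H A).hom ▷ H ⊗≫ A ◁ (μ[H] ≫ ε[H]) ⊗≫ 𝟙 _ := by
      rw [comoduleAlgebraEntwining]; monoidal
    _ = 𝟙 _ ⊗≫ H ◁ coact H A ⊗≫ ((β_ H A).hom ▷ H ≫ (A ⊗ H) ◁ ε[H]) ⊗≫ A ◁ ε[H] ⊗≫ 𝟙 _ := by
      rw [Bimon.mul_counit, MonoidalCategory.tensorHom_def']; monoidal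
    _ = 𝟙 _ ⊗≫ H ◁ (coact H A ≫ A ◁ ε[H]) ⊗≫ ((β_ H A).hom ≫ A ◁ ε[H]) ⊗≫ 𝟙 _ := by
      rw [← whisker_exchange]; monoidal
    _ = _ := by
      rw [h, ← BraidedCategory.braiding_naturality_left, braiding_tensorUnit_left]; monoidal

/-- Expanding Δ(h a₁) by multiplicativity of Δ and using coassociativity of the coaction gives both
sides; the remaining work is moving Δ and the coaction through braidings by naturality and the
hexagons. -/
theorem entwining_comul : comoduleAlgebraEntwining H A ≫ A ◁ Δ[H] =
    Δ[H] ▷ A ≫ (α_ H H A).hom ≫ H ◁ comoduleAlgebraEntwining H A ≫ (α_ H A H).inv ≫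
      comoduleAlgebraEntwining H A ▷ H ≫ (α_ A H H).hom := by
  have h : coact H A ≫ A ◁ Δ[H] = coact H A ≫ coact H A ▷ H ≫ (α_ A H H).hom :=
    RightComodObj.coact_comul
  calc
    _ = 𝟙 _ ⊗≫ H ◁ coact H A ⊗≫ (β_ H A).hom ▷ H ⊗≫ A ◁ (μ[H] ≫ Δ[H]) ⊗≫ 𝟙 _ := by
      rw [comoduleAlgebraEntwining]; monoidal
    _ = 𝟙 _ ⊗≫ H ◁ coact H A ⊗≫ ((β_ H A).hom ▷ H ≫ (A ⊗ H) ◁ Δ[H]) ⊗≫ A ◁ Δ[H] ▷ (H ⊗ H) ⊗≫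
        A ◁ H ◁ (β_ H H).hom ▷ H ⊗≫ A ◁ (μ[H] ⊗ₘ μ[H]) := by
      rw [BimonObj.mul_comul, tensorμ, MonoidalCategory.tensorHom_def' Δ[H]]; monoidal
    _ = 𝟙 _ ⊗≫ H ◁ (coact H A ≫ A ◁ Δ[H]) ⊗≫ ((β_ H A).hom ≫ A ◁ Δ[H]) ▷ (H ⊗ H) ⊗≫
        A ◁ H ◁ (β_ H H).hom ▷ H ⊗≫ A ◁ (μ[H] ⊗ₘ μ[H]) := by
      rw [← whisker_exchange]; monoidal
    _ = 𝟙 _ ⊗≫ (H ◁ (coact H A ≫ coact H A ▷ H) ≫ Δ[H] ▷ ((A ⊗ H) ⊗ H)) ⊗≫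
        H ◁ (β_ H A).hom ▷ H ▷ H ⊗≫ ((β_ H A).hom ▷ (H ⊗ H) ≫ (A ⊗ H) ◁ (β_ H H).hom) ▷ H ⊗≫
          A ◁ (μ[H] ⊗ₘ μ[H]) := by
      rw [h, ← BraidedCategory.braiding_naturality_left, BraidedCategory.braiding_tensor_left_hom]
      monoidal
    _ = 𝟙 _ ⊗≫ Δ[H] ▷ A ⊗≫ (H ⊗ H) ◁ (coact H A ≫ coact H A ▷ H) ⊗≫ H ◁ (β_ H A).hom ▷ H ▷ H ⊗≫
        H ◁ A ◁ (β_ H H).hom ▷ H ⊗≫ ((β_ H A).hom ▷ (H ⊗ H ⊗ H) ≫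
          (A ⊗ H) ◁ H ◁ μ[H]) ⊗≫ A ◁ μ[H] ▷ H := by
      rw [whisker_exchange, ← whisker_exchange (β_ H A).hom (β_ H H).hom,
        MonoidalCategory.tensorHom_def']
      monoidal
    -- The braidings past A and past H combine into the braiding past A ⊗ H, through which the
    -- second coaction slides by naturality.
    _ = 𝟙 _ ⊗≫ Δ[H] ▷ A ⊗≫ (H ⊗ H) ◁ coact H A ⊗≫ H ◁ (H ◁ coact H A ≫ (β_ H (A ⊗ H)).hom) ▷ H ⊗≫
        H ◁ (A ⊗ H) ◁ μ[H] ⊗≫ (β_ H A).hom ▷ H ▷ H ⊗≫ A ◁ μ[H] ▷ H := by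
      rw [← whisker_exchange, BraidedCategory.braiding_tensor_right_hom]; monoidal
    _ = 𝟙 _ ⊗≫ Δ[H] ▷ A ⊗≫ (H ⊗ H) ◁ coact H A ⊗≫ H ◁ (β_ H A).hom ▷ H ⊗≫
        H ◁ (coact H A ▷ (H ⊗ H) ≫ (A ⊗ H) ◁ μ[H]) ⊗≫ (β_ H A).hom ▷ H ▷ H ⊗≫
          A ◁ μ[H] ▷ H := by
      rw [BraidedCategory.braiding_naturality_right]; monoidal
    _ = _ := by
      rw [← whisker_exchange, comoduleAlgebraEntwining]; monoidal

/-- In elements, (h h') a₁ = h (h' a₁): associativity of H together with a hexagon. It serves to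
prove the product axiom of the entwining. -/
theorem mul_whiskerRight_entwining : μ[H] ▷ A ≫ comoduleAlgebraEntwining H A =
    (α_ H H A).hom ≫ H ◁ comoduleAlgebraEntwining H A ≫ (α_ H A H).inv ≫ (β_ H A).hom ▷ H ≫
      (α_ A H H).hom ≫ A ◁ μ[H] := by
  calc
    _ = 𝟙 _ ⊗≫ (μ[H] ▷ A ≫ H ◁ coact H A) ⊗≫ (β_ H A).hom ▷ H ⊗≫ A ◁ μ[H] := by
      rw [comoduleAlgebraEntwining]; monoidal
    _ = 𝟙 _ ⊗≫ (H ⊗ H) ◁ coact H A ⊗≫ (μ[H] ▷ A ≫ (β_ H A).hom) ▷ H ⊗≫ A ◁ μ[H] := by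
      rw [← whisker_exchange]; monoidal
    _ = 𝟙 _ ⊗≫ (H ⊗ H) ◁ coact H A ⊗≫ (β_ (H ⊗ H) A).hom ▷ H ⊗≫
        A ◁ (μ[H] ▷ H ≫ μ[H]) := by
      rw [BraidedCategory.braiding_naturality_left]; monoidal
    _ = 𝟙 _ ⊗≫ (H ⊗ H) ◁ coact H A ⊗≫ H ◁ (β_ H A).hom ▷ H ⊗≫
        ((β_ H A).hom ▷ (H ⊗ H) ≫ (A ⊗ H) ◁ μ[H]) ⊗≫ A ◁ μ[H] := by
      rw [MonObj.mul_assoc, BraidedCategory.braiding_tensor_left_hom]; monoidal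
    _ = _ := by
      rw [← whisker_exchange, comoduleAlgebraEntwining]; monoidal

variable [MonObj A] [IsRightComoduleAlgebra H A]

/-- Multiplicativity of the coaction says precisely that A, acting on itself by multiplication, is
an entwined module. -/
theorem self_entwined : μ[A] ≫ coact H A =
    coact H A ▷ A ≫ (α_ A H A).hom ≫ A ◁ comoduleAlgebraEntwining H A ≫ (α_ A A H).inv ≫
      μ[A] ▷ H := by
  let _ : RightModObj A A := ⟨μ[A], MonObj.mul_one _, by simp⟩
  have h := diagonalAct_eq H A A
  have e : act A A = μ[A] := rfl
  rw [e] at h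
  rw [← h, diagonalAct, coact_mul, MonoidalCategory.tensorHom_def, Category.assoc, e]

theorem entwining_one : H ◁ η[A] ≫ comoduleAlgebraEntwining H A =
    (ρ_ H).hom ≫ (λ_ H).inv ≫ η[A] ▷ H := by
  calc
    _ = 𝟙 _ ⊗≫ H ◁ (η[A] ≫ coact H A) ⊗≫ (β_ H A).hom ▷ H ⊗≫ A ◁ μ[H] := by
      rw [comoduleAlgebraEntwining]; monoidal
    _ = 𝟙 _ ⊗≫ H ◁ η[A] ⊗≫ ((H ⊗ A) ◁ η[H] ≫ (β_ H A).hom ▷ H) ⊗≫ A ◁ μ[H] := by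
      rw [coact_one_eq]; monoidal
    _ = 𝟙 _ ⊗≫ (H ◁ η[A] ≫ (β_ H A).hom) ⊗≫ A ◁ (H ◁ η[H] ≫ μ[H]) := by
      rw [whisker_exchange]; monoidal
    _ = _ := by
      rw [BraidedCategory.braiding_naturality_right, MonObj.mul_one, braiding_tensorUnit_right]
      monoidal

theorem entwining_mul : H ◁ μ[A] ≫ comoduleAlgebraEntwining H A =
    (α_ H A A).inv ≫ comoduleAlgebraEntwining H A ▷ A ≫ (α_ A H A).hom ≫
      A ◁ comoduleAlgebraEntwining H A ≫ (α_ A A H).inv ≫ μ[A] ▷ H := by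
  calc
    _ = 𝟙 _ ⊗≫ H ◁ (μ[A] ≫ coact H A) ⊗≫ (β_ H A).hom ▷ H ⊗≫ A ◁ μ[H] := by
      rw [comoduleAlgebraEntwining]; monoidal
    _ = 𝟙 _ ⊗≫ H ◁ coact H A ▷ A ⊗≫ H ◁ A ◁ comoduleAlgebraEntwining H A ⊗≫
        (H ◁ μ[A] ≫ (β_ H A).hom) ▷ H ⊗≫ A ◁ μ[H] := by
      rw [self_entwined]; monoidal
    _ = 𝟙 _ ⊗≫ H ◁ coact H A ▷ A ⊗≫ ((H ⊗ A) ◁ comoduleAlgebraEntwining H A ≫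
        (β_ H A).hom ▷ (A ⊗ H)) ⊗≫ A ◁ (β_ H A).hom ▷ H ⊗≫ (μ[A] ▷ (H ⊗ H) ≫ A ◁ μ[H]) := by
      rw [BraidedCategory.braiding_naturality_right, BraidedCategory.braiding_tensor_right_hom]
      monoidal
    _ = 𝟙 _ ⊗≫ H ◁ coact H A ▷ A ⊗≫ (β_ H A).hom ▷ (H ⊗ A) ⊗≫
        A ◁ ((α_ H H A).hom ≫ H ◁ comoduleAlgebraEntwining H A ≫ (α_ H A H).inv ≫
          (β_ H A).hom ▷ H ≫ (α_ A H H).hom ≫ A ◁ μ[H]) ⊗≫ μ[A] ▷ H := by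
      rw [whisker_exchange, ← whisker_exchange μ[A] μ[H]]; monoidal
    _ = _ := by
      rw [← mul_whiskerRight_entwining]
      -- Unfolding only the first entwining on the right exposes its product of H; the other remains
      -- opaque on both sides, leaving only coherence.
      nth_rw 2 [comoduleAlgebraEntwining]
      monoidal

theorem isEntwining : IsEntwining H A (comoduleAlgebraEntwining H A) :=
  ⟨entwining_one H A, entwining_counit H A, entwining_comul H A, entwining_mul H A⟩

end Entwining

/-! ### Entwined modules for an arbitrary entwining, as coalgebras over modules. -/

section EntwinedModules

variable {V : Type u} [Category.{v} V] [MonoidalCategory V] {C A : V} [ComonObj C] [MonObj A]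

/-- The action of `A` on `X ⊗ C` through an entwining. -/
abbrev entwinedAct (lam : C ⊗ A ⟶ A ⊗ C) (X : V) [RightModObj A X] : (X ⊗ C) ⊗ A ⟶ X ⊗ C :=
  (α_ X C A).hom ≫ X ◁ lam ≫ (α_ X A C).inv ≫ act A X ▷ C

/-- The coaction of `C` on `X ⊗ C` through the comultiplication. -/
@[reducible]
def cofreeComod (C X : V) [ComonObj C] : RightComodObj C (X ⊗ C) where
  coact := X ◁ Δ[C] ≫ (α_ X C C).inv
  coact_counit := by
    calc
      _ = X ◁ (Δ[C] ≫ C ◁ ε[C]) ⊗≫ 𝟙 _ := by monoidal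
      _ = _ := by rw [ComonObj.comul_counit]; monoidal
  coact_comul := by
    calc
      _ = 𝟙 _ ⊗≫ X ◁ (Δ[C] ≫ C ◁ Δ[C]) ⊗≫ 𝟙 _ := by monoidal
      _ = _ := by rw [ComonObj.comul_assoc]; monoidal

theorem act_whiskerLeft_mul (X : V) [RightModObj A X] :
    X ◁ μ[A] ≫ act A X = (α_ X A A).inv ≫ act A X ▷ A ≫ act A X := RightModObj.act_mul

theorem act_whiskerLeft_one (X : V) [RightModObj A X] : X ◁ η[A] ≫ act A X = (ρ_ X).hom :=
  RightModObj.act_one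

variable {lam : C ⊗ A ⟶ A ⊗ C}

/-- `X ⊗ C` is a right `A`-module. -/
@[reducible]
def IsEntwining.mod (h : IsEntwining C A lam) (X : V) [RightModObj A X] :
    RightModObj A (X ⊗ C) where
  act := entwinedAct lam X
  act_one := by
    calc
      _ = 𝟙 _ ⊗≫ X ◁ (C ◁ η[A] ≫ lam) ⊗≫ act A X ▷ C := by monoidal
      _ = 𝟙 _ ⊗≫ (X ◁ η[A] ≫ act A X) ▷ C := by rw [h.one]; monoidal
      _ = _ := by rw [act_whiskerLeft_one]; monoidal
  act_mul := by
    calc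
      _ = 𝟙 _ ⊗≫ X ◁ (C ◁ μ[A] ≫ lam) ⊗≫ act A X ▷ C := by monoidal
      _ = 𝟙 _ ⊗≫ X ◁ lam ▷ A ⊗≫ X ◁ A ◁ lam ⊗≫ (X ◁ μ[A] ≫ act A X) ▷ C := by
        rw [h.mul]; monoidal
      _ = 𝟙 _ ⊗≫ X ◁ lam ▷ A ⊗≫ ((X ⊗ A) ◁ lam ≫ act A X ▷ (A ⊗ C)) ⊗≫ act A X ▷ C := by
        rw [act_whiskerLeft_mul]; monoidal
      _ = _ := by
        rw [whisker_exchange]; monoidal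

/-- The comultiplication axiom of the entwining makes X ⊗ C, with its cofree coaction, an entwined
module. -/
theorem IsEntwining.entwinedAct_cofree (h : IsEntwining C A lam) (X : V) [RightModObj A X] :
    entwinedAct lam X ≫ X ◁ Δ[C] ≫ (α_ X C C).inv =
      (X ◁ Δ[C] ≫ (α_ X C C).inv) ▷ A ≫ (α_ (X ⊗ C) C A).hom ≫ (X ⊗ C) ◁ lam ≫
        (α_ (X ⊗ C) A C).inv ≫ entwinedAct lam X ▷ C := by
  calc
    _ = 𝟙 _ ⊗≫ X ◁ lam ⊗≫ (act A X ▷ C ≫ X ◁ Δ[C]) ⊗≫ 𝟙 _ := by monoidal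
    _ = 𝟙 _ ⊗≫ X ◁ (lam ≫ A ◁ Δ[C]) ⊗≫ act A X ▷ (C ⊗ C) ⊗≫ 𝟙 _ := by
      rw [← whisker_exchange]; monoidal
    _ = _ := by rw [h.comul]; monoidal

theorem IsEntwining.entwinedAct_counit (h : IsEntwining C A lam) (X : V) [RightModObj A X] :
    entwinedAct lam X ≫ X ◁ ε[C] ≫ (ρ_ X).hom = (X ◁ ε[C] ≫ (ρ_ X).hom) ▷ A ≫ act A X := by
  calc
    _ = 𝟙 _ ⊗≫ X ◁ lam ⊗≫ (act A X ▷ C ≫ X ◁ ε[C]) ⊗≫ 𝟙 _ := by monoidal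
    _ = 𝟙 _ ⊗≫ X ◁ (lam ≫ A ◁ ε[C] ≫ (ρ_ A).hom) ⊗≫ act A X := by
      rw [← whisker_exchange]; monoidal
    _ = _ := by rw [h.counit]; monoidal

/-- The category of entwined modules. -/
abbrev EntwinedModule (lam : C ⊗ A ⟶ A ⊗ C) := (isEntwinedModule C A lam).FullSubcategory

/-- The functor forgetting the coaction of an entwined module. -/
def forgetCoaction (P : ObjectProperty (ModComod A C)) : P.FullSubcategory ⥤ RightMod A where
  obj M := { X := M.obj.X }
  map f := { hom := f.hom.hom, act_hom := f.hom.act_hom }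

instance (P : ObjectProperty (ModComod A C)) : (forgetCoaction P).Faithful where
  map_injective h := by
    apply ObjectProperty.hom_ext
    apply ModComod.hom_ext
    exact congrArg (fun g => RightMod.Hom.hom g) h

/-- The entwined module `X ⊗ C`. -/
def IsEntwining.cofreeObj (h : IsEntwining C A lam) (N : RightMod A) : EntwinedModule lam :=
  letI := h.mod N.X
  letI := cofreeComod C N.X
  ⟨{ X := N.X ⊗ C }, h.entwinedAct_cofree N.X⟩

/-- The functor `X ↦ X ⊗ C` from modules to entwined modules. -/
def IsEntwining.cofree (h : IsEntwining C A lam) : RightMod A ⥤ EntwinedModule lam where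
  obj N := h.cofreeObj N
  map {N N'} f := ObjectProperty.homMk
    { hom := f.hom ▷ C
      act_hom := by
        change entwinedAct lam N.X ≫ f.hom ▷ C = f.hom ▷ C ▷ A ≫ entwinedAct lam N'.X
        simp only [entwinedAct, Category.assoc, ← comp_whiskerRight, f.act_hom]
        rw [associator_naturality_left_assoc, ← whisker_exchange_assoc]
        simp
      hom_coact := by
        change f.hom ▷ C ≫ N'.X ◁ Δ[C] ≫ _ = (N.X ◁ Δ[C] ≫ _) ≫ f.hom ▷ C ▷ C
        rw [← whisker_exchange_assoc]
        simp }
  map_id N := by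
    apply ObjectProperty.hom_ext
    apply ModComod.hom_ext
    exact id_whiskerRight N.X C
  map_comp f g := by
    apply ObjectProperty.hom_ext
    apply ModComod.hom_ext
    exact comp_whiskerRight f.hom g.hom C

/-- The coaction of an entwined module, as a morphism of entwined modules. -/
def IsEntwining.coactHom (h : IsEntwining C A lam) (M : EntwinedModule lam) :
    M ⟶ h.cofree.obj ((forgetCoaction _).obj M) :=
  ObjectProperty.homMk
    { hom := coact C M.obj.X
      -- The entwined module condition is literally A-linearity of the coaction.
      act_hom := M.property
      hom_coact := by
        change coact C M.obj.X ≫ M.obj.X ◁ Δ[C] ≫ (α_ M.obj.X C C).inv = _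
        have e : coact C M.obj.X ≫ M.obj.X ◁ Δ[C] = _ := RightComodObj.coact_comul
        rw [← Category.assoc, e]
        simp only [Category.assoc, Iso.hom_inv_id, Category.comp_id]
        rfl }

/-- The morphism `X ⊗ ε : X ⊗ C ⟶ X` of `A`-modules. -/
def IsEntwining.counitHom (h : IsEntwining C A lam) (N : RightMod A) :
    (forgetCoaction _).obj (h.cofree.obj N) ⟶ N :=
  { hom := N.X ◁ ε[C] ≫ (ρ_ N.X).hom
    act_hom := h.entwinedAct_counit N.X }

/-- Forgetting the coaction is left adjoint to `X ↦ X ⊗ C`. -/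
def IsEntwining.cofreeAdj (h : IsEntwining C A lam) :
    forgetCoaction (isEntwinedModule C A lam) ⊣ h.cofree :=
  Adjunction.mkOfUnitCounit
    { unit :=
        { app M := h.coactHom M
          naturality M N f := by
            apply ObjectProperty.hom_ext
            apply ModComod.hom_ext
            exact f.hom.hom_coact }
      counit :=
        { app N := h.counitHom N
          naturality M N f := by
            apply RightMod.hom_ext
            change f.hom ▷ C ≫ N.X ◁ ε[C] ≫ (ρ_ N.X).hom =
              (M.X ◁ ε[C] ≫ (ρ_ M.X).hom) ≫ f.hom
            rw [← whisker_exchange_assoc]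
            simp }
      left_triangle := by
        ext M
        change coact C M.obj.X ≫ 𝟙 _ ≫ M.obj.X ◁ ε[C] ≫ (ρ_ M.obj.X).hom = 𝟙 _
        have e : coact C M.obj.X ≫ M.obj.X ◁ ε[C] = _ := RightComodObj.coact_counit
        rw [Category.id_comp, ← Category.assoc, e, Iso.inv_hom_id]
      right_triangle := by
        ext N
        change (N.X ◁ Δ[C] ≫ (α_ N.X C C).inv) ≫ 𝟙 _ ≫ (N.X ◁ ε[C] ≫ (ρ_ N.X).hom) ▷ C = 𝟙 _
        calc
          _ = N.X ◁ (Δ[C] ≫ ε[C] ▷ C) ⊗≫ 𝟙 _ := by monoidal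
          _ = _ := by rw [ComonObj.counit_comul]; monoidal }

/-- The counit and coassociativity laws of a coalgebra are the comodule axioms, and linearity of its
structure morphism is the entwined module condition. -/
theorem IsEntwining.comparison_isEquivalence (h : IsEntwining C A lam) :
    (Comonad.comparison h.cofreeAdj).IsEquivalence where
  -- The faithfulness field is filled by instance search, from faithfulness of `forgetCoaction`.
  full := ⟨fun {M M'} g => ⟨ObjectProperty.homMk
    { hom := g.f.hom
      act_hom := g.f.act_hom
      hom_coact := (congrArg (fun k => RightMod.Hom.hom k) g.h).symm }, rfl⟩⟩
  essSurj := ⟨fun Y => by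
    let a : Y.A.X ⟶ Y.A.X ⊗ C := Y.a.hom
    have h₁ : a ≫ Y.A.X ◁ ε[C] ≫ (ρ_ Y.A.X).hom = 𝟙 _ :=
      congrArg (fun k => RightMod.Hom.hom k) Y.counit
    have h₂ : a ≫ Y.A.X ◁ Δ[C] ≫ (α_ Y.A.X C C).inv = a ≫ a ▷ C :=
      congrArg (fun k => RightMod.Hom.hom k) Y.coassoc
    let comod : RightComodObj C Y.A.X :=
      { coact := a
        coact_counit := by rw [← cancel_mono (ρ_ Y.A.X).hom, Category.assoc, h₁, Iso.inv_hom_id]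
        coact_comul := by
          rw [← cancel_mono (α_ Y.A.X C C).inv]
          simpa using h₂ }
    let M : EntwinedModule lam := ⟨{ X := Y.A.X }, Y.a.act_hom⟩
    refine ⟨M, ⟨Comonad.Coalgebra.isoMk (Iso.refl _) ?_⟩⟩
    apply RightMod.hom_ext
    change a ≫ 𝟙 Y.A.X ▷ C = 𝟙 _ ≫ a
    rw [id_whiskerRight, Category.comp_id, Category.id_comp]⟩

end EntwinedModules

/-! ### Extension and restriction of scalars along a morphism of algebras. -/

section Restriction

variable {V : Type u} [Category.{v} V] [MonoidalCategory V] {B A : V} [MonObj A] (i : B ⟶ A)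

/-- Associativity of the action makes it balanced over B, so that it descends to the counit N ⊗_B A
⟶ N. -/
theorem act_restrict_leftAct (X : V) [RightModObj A X] :
    (X ◁ i ≫ act A X) ▷ A ≫ act A X = (α_ X B A).hom ≫ X ◁ leftAct i ≫ act A X := by
  have h : act A X ▷ A ≫ act A X = (α_ X A A).hom ≫ X ◁ μ[A] ≫ act A X := by
    rw [act_whiskerLeft_mul, Iso.hom_inv_id_assoc]
  rw [comp_whiskerRight, Category.assoc, h, leftAct]
  simp

variable [MonObj B]

theorem tensorOver.hom_ext [HasCoequalizers V] (M : RightMod B) {Z : V} {f g : tensorOver i M ⟶ Z}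
    (h : tensorOver.π i M ≫ f = tensorOver.π i M ≫ g) : f = g :=
  (cancel_epi _).1 h

theorem tensorOver.π_act [HasCoequalizers V]
    [∀ X : V, PreservesColimitsOfShape WalkingParallelPair (tensorRight X)] (M : RightMod B) :
    tensorOver.π i M ▷ A ≫ act A (tensorOver i M) =
      (α_ M.X A A).hom ≫ M.X ◁ μ[A] ≫ tensorOver.π i M :=
  tensorOver.π_rightAct i M

/-- In elements (m ⊗ 1) a = m ⊗ a; this is the content of one triangle identity. -/
theorem tensorOver.unit_whiskerRight_act [HasCoequalizers V]
    [∀ X : V, PreservesColimitsOfShape WalkingParallelPair (tensorRight X)] (M : RightMod B) :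
    ((ρ_ M.X).inv ≫ M.X ◁ η[A] ≫ tensorOver.π i M) ▷ A ≫ act A (tensorOver i M) =
      tensorOver.π i M := by
  calc
    _ = 𝟙 _ ⊗≫ M.X ◁ η[A] ▷ A ⊗≫ tensorOver.π i M ▷ A ≫ act A (tensorOver i M) := by
      monoidal
    _ = 𝟙 _ ⊗≫ M.X ◁ (η[A] ▷ A ≫ μ[A]) ≫ tensorOver.π i M := by
      rw [tensorOver.π_act]; monoidal
    _ = _ := by rw [MonObj.one_mul]; monoidal

variable [IsMonHom i]

/-- Restriction of the action along a morphism of algebras. -/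
@[reducible]
def restrictAct (X : V) [RightModObj A X] : RightModObj B X where
  act := X ◁ i ≫ act A X
  act_one := by
    rw [← Category.assoc, ← whiskerLeft_comp, IsMonHom.one_hom, act_whiskerLeft_one]
  act_mul := by
    rw [← Category.assoc, ← whiskerLeft_comp, IsMonHom.mul_hom, MonoidalCategory.tensorHom_def]
    simp only [MonoidalCategory.whiskerLeft_comp, Category.assoc, comp_whiskerRight]
    rw [act_whiskerLeft_mul, ← associator_inv_naturality_middle_assoc, ← whisker_exchange_assoc]
    simp

/-- Restriction of scalars. -/
abbrev restrict (N : RightMod A) : RightMod B :=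
  letI := restrictAct i N.X
  { X := N.X }

/-- The restriction of scalars functor. -/
def restrictionOfScalars : RightMod A ⥤ RightMod B where
  obj N := restrict i N
  map {N N'} f :=
    { hom := f.hom
      act_hom := by
        change (N.X ◁ i ≫ act A N.X) ≫ f.hom = f.hom ▷ B ≫ N'.X ◁ i ≫ act A N'.X
        rw [Category.assoc, f.act_hom, whisker_exchange_assoc] }

variable [HasCoequalizers V]

/-- The morphism `N ⊗_B A ⟶ N`, `n ⊗ a ↦ n a`. -/
noncomputable def tensorOver.descAct (N : RightMod A) : tensorOver i (restrict i N) ⟶ N.X :=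
  tensorOver.desc i (restrict i N) (act A N.X) (act_restrict_leftAct i N.X)

theorem tensorOver.π_descAct (N : RightMod A) :
    tensorOver.π i (restrict i N) ≫ tensorOver.descAct i N = act A N.X :=
  tensorOver.π_desc _ _ _ _

theorem tensorOver.π_map_descAct {M : RightMod B} {N : RightMod A} (g : M ⟶ restrict i N) :
    tensorOver.π i M ≫ tensorOver.map i g ≫ tensorOver.descAct i N = g.hom ▷ A ≫ act A N.X := by
  rw [← Category.assoc, tensorOver.π_map, Category.assoc, tensorOver.π_descAct]

variable [∀ X : V, PreservesColimitsOfShape WalkingParallelPair (tensorRight X)]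

/-- The unit `m ↦ m ⊗ 1` of the adjunction between extension and restriction of scalars. -/
noncomputable def restrictionUnit (M : RightMod B) :
    M ⟶ (restrictionOfScalars i).obj ((extensionOfScalars i).obj M) where
  hom := (ρ_ M.X).inv ≫ M.X ◁ η[A] ≫ tensorOver.π i M
  act_hom := by
    change act B M.X ≫ _ = _ ≫ tensorOver i M ◁ i ≫ act A (tensorOver i M)
    -- In elements: m b ⊗ 1 = m ⊗ i(b) 1 = m ⊗ i(b) = m ⊗ 1 i(b) = (m ⊗ 1) i(b).
    calc
      _ = 𝟙 _ ⊗≫ (act B M.X ▷ 𝟙_ V ≫ M.X ◁ η[A]) ≫ tensorOver.π i M := by monoidal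
      _ = 𝟙 _ ⊗≫ M.X ◁ B ◁ η[A] ⊗≫ act B M.X ▷ A ≫ tensorOver.π i M := by
        rw [← whisker_exchange]; monoidal
      _ = 𝟙 _ ⊗≫ M.X ◁ (B ◁ η[A] ≫ i ▷ A ≫ μ[A]) ≫ tensorOver.π i M := by
        rw [tensorOver.condition, leftAct]; monoidal
      _ = 𝟙 _ ⊗≫ M.X ◁ i ≫ tensorOver.π i M := by
        rw [whisker_exchange_assoc, MonObj.mul_one]; monoidal
      _ = 𝟙 _ ⊗≫ M.X ◁ i ⊗≫ M.X ◁ (η[A] ▷ A ≫ μ[A]) ≫ tensorOver.π i M := by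
        rw [MonObj.one_mul]; monoidal
      _ = 𝟙 _ ⊗≫ M.X ◁ (𝟙_ V ◁ i ≫ η[A] ▷ A) ⊗≫ tensorOver.π i M ▷ A ≫
          act A (tensorOver i M) := by
        rw [tensorOver.π_act]; monoidal
      _ = 𝟙 _ ⊗≫ M.X ◁ η[A] ▷ B ⊗≫ ((M.X ⊗ A) ◁ i ≫ tensorOver.π i M ▷ A) ≫
          act A (tensorOver i M) := by
        rw [whisker_exchange]; monoidal
      _ = _ := by rw [whisker_exchange]; monoidal

theorem tensorOver.act_descAct (N : RightMod A) :
    act A (tensorOver i (restrict i N)) ≫ tensorOver.descAct i N =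
      tensorOver.descAct i N ▷ A ≫ act A N.X := by
  refine (cancel_epi (tensorOver.π i (restrict i N) ▷ A)).1 ?_
  rw [← comp_whiskerRight_assoc, tensorOver.π_descAct, ← Category.assoc, tensorOver.π_act,
    Category.assoc, Category.assoc, tensorOver.π_descAct, act_whiskerLeft_mul,
    Iso.hom_inv_id_assoc]

/-- Extension of scalars is left adjoint to restriction of scalars. -/
noncomputable def restrictionAdj : extensionOfScalars i ⊣ restrictionOfScalars i :=
  Adjunction.mkOfUnitCounit
    { unit :=
        { app M := restrictionUnit i M
          naturality M N f := by
            apply RightMod.hom_ext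
            change f.hom ≫ (ρ_ N.X).inv ≫ N.X ◁ η[A] ≫ tensorOver.π i N =
              ((ρ_ M.X).inv ≫ M.X ◁ η[A] ≫ tensorOver.π i M) ≫ tensorOver.map i f
            simp only [Category.assoc, tensorOver.π_map]
            rw [whisker_exchange_assoc]
            simp }
      counit :=
        { app N := { hom := tensorOver.descAct i N, act_hom := tensorOver.act_descAct i N }
          naturality N N' f := by
            apply RightMod.hom_ext
            refine tensorOver.hom_ext i (restrict i N) ?_
            refine (tensorOver.π_map_descAct i ((restrictionOfScalars i).map f)).trans ?_
            exact f.act_hom.symm.trans (((tensorOver.π_descAct i N).symm =≫ f.hom).trans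
              (Category.assoc _ _ _)) }
      left_triangle := by
        ext M
        refine tensorOver.hom_ext i M ?_
        refine ((tensorOver.π i M ≫= (tensorOver.map i (restrictionUnit i M) ≫=
          Category.id_comp _)).trans (tensorOver.π_map_descAct i (restrictionUnit i M))).trans ?_
        exact (tensorOver.unit_whiskerRight_act i M).trans (Category.comp_id _).symm
      right_triangle := by
        ext N
        change ((ρ_ N.X).inv ≫ N.X ◁ η[A] ≫ tensorOver.π i (restrict i N)) ≫
          𝟙 (tensorOver i (restrict i N)) ≫ tensorOver.descAct i N = 𝟙 _
        rw [Category.id_comp, Category.assoc, Category.assoc, tensorOver.π_descAct,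
          act_whiskerLeft_one, Iso.inv_hom_id] }

end Restriction

/-! ### The action of N on A ⊗_B A, with values in N ⊗_B A. -/

section Regular

variable {V : Type u} [Category.{v} V] [MonoidalCategory V]

/-- The algebra `A` as a right module over itself. -/
abbrev regularMod (A : V) [MonObj A] : RightMod A :=
  letI : RightModObj A A := ⟨μ[A], MonObj.mul_one _, by simp⟩
  { X := A }

variable {B A : V} [MonObj B] [MonObj A] (i : B ⟶ A) [HasCoequalizers V]
  [∀ X : V, PreservesColimitsOfShape WalkingParallelPair (tensorLeft X)]

instance tensorOver.epi_whiskerLeft (Z : V) (M : RightMod B) : Epi (Z ◁ tensorOver.π i M) :=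
  inferInstanceAs (Epi ((tensorLeft Z).map (coequalizer.π _ _)))

/-- The morphism `Z ⊗ (M ⊗_B A) ⟶ W` induced by a balanced morphism `Z ⊗ (M ⊗ A) ⟶ W`. -/
noncomputable def tensorOver.whiskerLeftDesc {Z W : V} (M : RightMod B) (f : Z ⊗ M.X ⊗ A ⟶ W)
    (hf : Z ◁ act B M.X ▷ A ≫ f = Z ◁ ((α_ M.X B A).hom ≫ M.X ◁ leftAct i) ≫ f) :
    Z ⊗ tensorOver i M ⟶ W :=
  (isColimitOfHasCoequalizerOfPreservesColimit (tensorLeft Z) (act B M.X ▷ A)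
    ((α_ M.X B A).hom ≫ M.X ◁ leftAct i)).desc (Cofork.ofπ f hf)

theorem tensorOver.whiskerLeft_π_desc {Z W : V} (M : RightMod B) (f : Z ⊗ M.X ⊗ A ⟶ W)
    (hf : Z ◁ act B M.X ▷ A ≫ f = Z ◁ ((α_ M.X B A).hom ≫ M.X ◁ leftAct i) ≫ f) :
    Z ◁ tensorOver.π i M ≫ tensorOver.whiskerLeftDesc i M f hf = f :=
  (isColimitOfHasCoequalizerOfPreservesColimit (tensorLeft Z) (act B M.X ▷ A)
    ((α_ M.X B A).hom ≫ M.X ◁ leftAct i)).fac _ WalkingParallelPair.one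

variable [IsMonHom i]

/-- The morphism `N ⊗ (A ⊗_B A) ⟶ N ⊗_B A`, `n ⊗ (a ⊗ a') ↦ n a ⊗ a'`. -/
noncomputable def tensorOver.leftMul (N : RightMod A) :
    N.X ⊗ tensorOver i (restrict i (regularMod A)) ⟶ tensorOver i (restrict i N) :=
  tensorOver.whiskerLeftDesc i (restrict i (regularMod A))
    ((α_ N.X A A).inv ≫ act A N.X ▷ A ≫ tensorOver.π i (restrict i N)) (by
        change N.X ◁ ((A ◁ i ≫ μ[A]) ▷ A) ≫ _ = N.X ◁ ((α_ A B A).hom ≫ A ◁ leftAct i) ≫ _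
        have h := tensorOver.condition i (restrict i N)
        change (N.X ◁ i ≫ act A N.X) ▷ A ≫ _ = _ at h
        -- Balancedness, in elements: n (a i(b)) ⊗ a' = (n a) i(b) ⊗ a' = n a ⊗ i(b) a'.
        calc
          _ = 𝟙 _ ⊗≫ N.X ◁ A ◁ i ▷ A ⊗≫ (N.X ◁ μ[A] ≫ act A N.X) ▷ A ≫
              tensorOver.π i (restrict i N) := by monoidal
          _ = 𝟙 _ ⊗≫ ((N.X ⊗ A) ◁ i ≫ act A N.X ▷ A) ▷ A ⊗≫ act A N.X ▷ A ≫
              tensorOver.π i (restrict i N) := by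
            rw [act_whiskerLeft_mul]; monoidal
          _ = 𝟙 _ ⊗≫ act A N.X ▷ B ▷ A ⊗≫ (N.X ◁ i ≫ act A N.X) ▷ A ≫
              tensorOver.π i (restrict i N) := by
            rw [whisker_exchange]; monoidal
          _ = 𝟙 _ ⊗≫ (act A N.X ▷ (B ⊗ A) ≫ N.X ◁ leftAct i) ≫
              tensorOver.π i (restrict i N) := by
            rw [h]; monoidal
          _ = _ := by
            rw [← whisker_exchange]; monoidal)

theorem tensorOver.whiskerLeft_π_leftMul (N : RightMod A) :
    N.X ◁ tensorOver.π i (restrict i (regularMod A)) ≫ tensorOver.leftMul i N =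
      (α_ N.X A A).inv ≫ act A N.X ▷ A ≫ tensorOver.π i (restrict i N) :=
  tensorOver.whiskerLeft_π_desc i _ _ _

/-- The associativity law (n a) · t = n · (a · t) for t in A ⊗_B A, checked on representatives t =
a' ⊗ a''. -/
theorem tensorOver.act_whiskerRight_leftMul (N : RightMod A) :
    act A N.X ▷ tensorOver i (restrict i (regularMod A)) ≫ tensorOver.leftMul i N =
      (α_ _ _ _).hom ≫ N.X ◁ tensorOver.leftMul i (regularMod A) ≫ tensorOver.leftMul i N := by
  refine (cancel_epi ((N.X ⊗ A) ◁ tensorOver.π i (restrict i (regularMod A)))).1 ?_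
  have h := tensorOver.whiskerLeft_π_leftMul i N
  have h' : A ◁ tensorOver.π i (restrict i (regularMod A)) ≫
    tensorOver.leftMul i (regularMod A) = (α_ A A A).inv ≫ μ[A] ▷ A ≫
      tensorOver.π i (restrict i (regularMod A)) := tensorOver.whiskerLeft_π_leftMul i (regularMod A)
  calc
    _ = act A N.X ▷ (A ⊗ A) ≫ (α_ _ _ _).inv ≫ act A N.X ▷ A ≫
        tensorOver.π i (restrict i N) := by
      rw [whisker_exchange_assoc, h]
    _ = 𝟙 _ ⊗≫ ((α_ N.X A A).inv ≫ act A N.X ▷ A ≫ act A N.X) ▷ A ≫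
        tensorOver.π i (restrict i N) := by
      monoidal
    _ = 𝟙 _ ⊗≫ N.X ◁ (μ[A] ▷ A) ≫ (α_ _ _ _).inv ≫ act A N.X ▷ A ≫
        tensorOver.π i (restrict i N) := by
      rw [← act_whiskerLeft_mul]; monoidal
    _ = 𝟙 _ ⊗≫ N.X ◁ ((α_ A A A).inv ≫ μ[A] ▷ A ≫
        tensorOver.π i (restrict i (regularMod A))) ≫ tensorOver.leftMul i N := by
      rw [← h]; monoidal
    _ = _ := by
      rw [← h']; monoidal

end Regular

/-! ### The canonical morphisms, and the reduction of all modules to the regular one. -/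

section Galois

variable {V : Type u} [Category.{v} V] [MonoidalCategory V] [BraidedCategory V] [HasEqualizers V]
  [HasCoequalizers V]
variable (H A : V) [BimonObj H] [MonObj A] [RightComodObj H A] [IsRightComoduleAlgebra H A]

/-- The canonical morphism `N ⊗_{A^H} A ⟶ N ⊗ H`, `n ⊗ a ↦ n a₀ ⊗ a₁`, for a right `A`-module. -/
noncomputable def canMod (N : RightMod A) :
    tensorOver (coinvariants.ι H A) (restrict (coinvariants.ι H A) N) ⟶ N.X ⊗ H :=
  tensorOver.coaction H A _ ≫ tensorOver.descAct _ N ▷ H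

theorem π_canMod (N : RightMod A) :
    tensorOver.π (coinvariants.ι H A) (restrict _ N) ≫ canMod H A N =
      N.X ◁ coact H A ≫ (α_ N.X A H).inv ≫ act A N.X ▷ H := by
  rw [canMod, ← Category.assoc, tensorOver.π_coaction]
  simp only [Category.assoc]
  rw [← comp_whiskerRight, tensorOver.π_descAct]

/-- Both are induced by the same morphism on A ⊗ A; restricting the regular module gives
`RightMod.ofHom` definitionally. -/
theorem canMod_regular : canMod H A (regularMod A) = can H A := by
  refine tensorOver.hom_ext (coinvariants.ι H A) (restrict _ (regularMod A)) ((π_canMod H A (regularMod A)).trans ?_)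
  exact (tensorOver.π_desc (coinvariants.ι H A) (RightMod.ofHom (coinvariants.ι H A)) _
    (can_balanced H A)).symm

section LeftTensor

variable [∀ X : V, PreservesColimitsOfShape WalkingParallelPair (tensorLeft X)]

/-- In elements can_N(n · t) = n · can(t): the canonical morphism of N is determined by that of A on
elements n · t. -/
theorem leftMul_canMod (N : RightMod A) :
    tensorOver.leftMul _ N ≫ canMod H A N =
      N.X ◁ canMod H A (regularMod A) ≫ (α_ N.X A H).inv ≫ act A N.X ▷ H := by
  refine (cancel_epi (N.X ◁ tensorOver.π (coinvariants.ι H A) (restrict _ (regularMod A)))).1 ?_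
  have h := tensorOver.whiskerLeft_π_leftMul (coinvariants.ι H A) N
  have h' : tensorOver.π (coinvariants.ι H A) (restrict _ (regularMod A)) ≫
    canMod H A (regularMod A) = A ◁ coact H A ≫ (α_ A A H).inv ≫ μ[A] ▷ H :=
    π_canMod H A (regularMod A)
  rw [← Category.assoc, h, ← whiskerLeft_comp_assoc, h']
  simp only [Category.assoc]
  rw [π_canMod]
  calc
    _ = 𝟙 _ ⊗≫ (act A N.X ▷ A ≫ N.X ◁ coact H A) ⊗≫ act A N.X ▷ H := by monoidal
    _ = 𝟙 _ ⊗≫ N.X ◁ A ◁ coact H A ⊗≫ ((α_ _ _ _).inv ≫ act A N.X ▷ A ≫ act A N.X) ▷ H := by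
      rw [← whisker_exchange]; monoidal
    _ = _ := by rw [← act_whiskerLeft_mul]; monoidal

/-- If `A` is `H`-Galois, the canonical morphism of every right `A`-module is invertible. -/
theorem isIso_canMod [IsIso (canMod H A (regularMod A))] (N : RightMod A) :
    IsIso (canMod H A N) := by
  -- The translation map h ↦ can⁻¹(1 ⊗ h).
  let j : H ⟶ tensorOver (coinvariants.ι H A) (restrict _ (regularMod A)) :=
    (λ_ H).inv ≫ η[A] ▷ H ≫ inv (canMod H A (regularMod A))
  have hj : j ≫ canMod H A (regularMod A) = (λ_ H).inv ≫ η[A] ▷ H := by simp [j]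
  have hc : tensorOver.π (coinvariants.ι H A) (restrict _ (regularMod A)) ≫
    canMod H A (regularMod A) = A ◁ coact H A ≫ (α_ A A H).inv ≫ μ[A] ▷ H :=
    π_canMod H A (regularMod A)
  have hl : tensorOver.leftMul (coinvariants.ι H A) (regularMod A) ≫ canMod H A (regularMod A) =
    A ◁ canMod H A (regularMod A) ≫ (α_ A A H).inv ≫ μ[A] ▷ H := leftMul_canMod H A (regularMod A)
  -- In elements a₀ · j(a₁) = 1 ⊗ a, since can sends both sides to a₀ ⊗ a₁.
  have key : coact H A ≫ A ◁ j ≫ tensorOver.leftMul (coinvariants.ι H A) (regularMod A) =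
      (λ_ A).inv ≫ η[A] ▷ A ≫ tensorOver.π (coinvariants.ι H A) (restrict _ (regularMod A)) := by
    refine (cancel_mono (canMod H A (regularMod A))).1 ?_
    simp only [Category.assoc]
    rw [hl, hc, ← whiskerLeft_comp_assoc, hj]
    calc
      _ = coact H A ⊗≫ (A ◁ η[A] ≫ μ[A]) ▷ H := by monoidal
      _ = 𝟙 _ ⊗≫ 𝟙_ V ◁ coact H A ⊗≫ (η[A] ▷ A ≫ μ[A]) ▷ H := by
        rw [MonObj.mul_one, MonObj.one_mul]; monoidal
      _ = 𝟙 _ ⊗≫ (𝟙_ V ◁ coact H A ≫ η[A] ▷ (A ⊗ H)) ⊗≫ μ[A] ▷ H := by monoidal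
      _ = _ := by rw [whisker_exchange]; monoidal
  -- The inverse is n ⊗ h ↦ n · j(h). One composite is (n a₀) · j(a₁) = n · (1 ⊗ a) = n ⊗ a, the
  -- other n · can(j(h)) = n ⊗ h.
  refine ⟨N.X ◁ j ≫ tensorOver.leftMul _ N, ?_, ?_⟩
  · refine tensorOver.hom_ext _ (restrict _ N) ?_
    rw [← Category.assoc, π_canMod]
    calc
      _ = N.X ◁ coact H A ≫ (α_ N.X A H).inv ≫ (act A N.X ▷ H ≫ N.X ◁ j) ≫
          tensorOver.leftMul _ N := by simp only [Category.assoc]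
      _ = N.X ◁ coact H A ≫ (α_ N.X A H).inv ≫ (N.X ⊗ A) ◁ j ≫ (α_ _ _ _).hom ≫
          N.X ◁ tensorOver.leftMul _ (regularMod A) ≫ tensorOver.leftMul _ N := by
        rw [← whisker_exchange, Category.assoc, tensorOver.act_whiskerRight_leftMul]
      _ = N.X ◁ (coact H A ≫ A ◁ j ≫ tensorOver.leftMul _ (regularMod A)) ≫
          tensorOver.leftMul _ N := by monoidal
      _ = N.X ◁ ((λ_ A).inv ≫ η[A] ▷ A) ≫ N.X ◁ tensorOver.π _ (restrict _ (regularMod A)) ≫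
          tensorOver.leftMul _ N := by
        rw [key]; monoidal
      _ = 𝟙 _ ⊗≫ (N.X ◁ η[A] ≫ act A N.X) ▷ A ≫ tensorOver.π _ (restrict _ N) := by
        rw [tensorOver.whiskerLeft_π_leftMul]; monoidal
      _ = _ := by rw [act_whiskerLeft_one]; monoidal
  · rw [Category.assoc, leftMul_canMod, ← whiskerLeft_comp_assoc, hj]
    calc
      _ = 𝟙 _ ⊗≫ (N.X ◁ η[A] ≫ act A N.X) ▷ H := by monoidal
      _ = _ := by rw [act_whiskerLeft_one]; monoidal

end LeftTensor

variable [∀ X : V, PreservesColimitsOfShape WalkingParallelPair (tensorRight X)]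

/-- The condition for A itself, `self_entwined`, tensored with M and descended along the epimorphism
M ⊗ A ⊗ A ⟶ (M ⊗_B A) ⊗ A. -/
theorem inducedModComod_isEntwinedModule (M : RightMod (coinvariants H A)) :
    isEntwinedModule H A (comoduleAlgebraEntwining H A) ((inducedModComod H A).obj M) := by
  let T := tensorOver (coinvariants.ι H A) M
  let p : M.X ⊗ A ⟶ T := tensorOver.π (coinvariants.ι H A) M
  have hc : p ≫ coact H T = M.X ◁ coact H A ≫ (α_ M.X A H).inv ≫ p ▷ H :=
    tensorOver.π_coaction H A M
  have ha : p ▷ A ≫ act A T = (α_ M.X A A).hom ≫ M.X ◁ μ[A] ≫ p := tensorOver.π_act _ M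
  change act A T ≫ coact H T = coact H T ▷ A ≫ (α_ T H A).hom ≫
    T ◁ comoduleAlgebraEntwining H A ≫ (α_ T A H).inv ≫ act A T ▷ H
  refine (cancel_epi (tensorOver.π (coinvariants.ι H A) M ▷ A)).1 ?_
  change p ▷ A ≫ _ = p ▷ A ≫ _
  calc
    _ = (α_ M.X A A).hom ≫ M.X ◁ (μ[A] ≫ coact H A) ≫ (α_ M.X A H).inv ≫ p ▷ H := by
      rw [← Category.assoc, ha, Category.assoc, Category.assoc, hc]; monoidal
    _ = 𝟙 _ ⊗≫ M.X ◁ coact H A ▷ A ⊗≫ M.X ◁ A ◁ comoduleAlgebraEntwining H A ⊗≫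
        ((α_ M.X A A).hom ≫ M.X ◁ μ[A] ≫ p) ▷ H := by
      rw [self_entwined]; monoidal
    _ = 𝟙 _ ⊗≫ M.X ◁ coact H A ▷ A ⊗≫ ((M.X ⊗ A) ◁ comoduleAlgebraEntwining H A ≫
        p ▷ (A ⊗ H)) ⊗≫ act A T ▷ H := by
      rw [← ha]; monoidal
    _ = 𝟙 _ ⊗≫ (M.X ◁ coact H A ≫ (α_ M.X A H).inv ≫ p ▷ H) ▷ A ⊗≫
        T ◁ comoduleAlgebraEntwining H A ⊗≫ act A T ▷ H := by
      rw [whisker_exchange]; monoidal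
    _ = _ := by rw [← hc]; monoidal

end Galois

/-! ### Isomorphisms of modules with coaction are detected on underlying objects. -/

section ReflectsIso

variable {V : Type u} [Category.{v} V] [MonoidalCategory V] {A C : V} [MonObj A] [ComonObj C]

theorem isIso_hom_hom_iff {P : ObjectProperty (ModComod A C)} {M N : P.FullSubcategory}
    (f : M ⟶ N) : IsIso f.hom.hom ↔ IsIso f := by
  constructor
  · intro _
    refine ⟨ObjectProperty.homMk
      { hom := inv f.hom.hom
        act_hom := ?_
        hom_coact := ?_ }, ?_, ?_⟩
    · rw [← cancel_epi (f.hom.hom ▷ A), ← Category.assoc, ← f.hom.act_hom, Category.assoc,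
        IsIso.hom_inv_id, ← comp_whiskerRight_assoc, IsIso.hom_inv_id]
      simp
    · rw [← cancel_epi f.hom.hom, IsIso.hom_inv_id_assoc, ← Category.assoc, f.hom.hom_coact,
        Category.assoc, ← comp_whiskerRight, IsIso.hom_inv_id]
      simp
    · exact ObjectProperty.hom_ext _ (ModComod.hom_ext (IsIso.hom_inv_id f.hom.hom))
    · exact ObjectProperty.hom_ext _ (ModComod.hom_ext (IsIso.inv_hom_id f.hom.hom))
  · intro _
    exact ⟨(inv f).hom.hom,
      congrArg (fun g => ModComod.Hom.hom (InducedCategory.Hom.hom g)) (IsIso.hom_inv_id f),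
      congrArg (fun g => ModComod.Hom.hom (InducedCategory.Hom.hom g)) (IsIso.inv_hom_id f)⟩

end ReflectsIso

/-! ### The Galois condition as invertibility of the mate, and the equivalence criterion. -/

section Main

variable {V : Type u} [Category.{v} V] [MonoidalCategory V] [BraidedCategory V] [HasEqualizers V]
  [HasCoequalizers V] [∀ X : V, PreservesColimitsOfShape WalkingParallelPair (tensorLeft X)]
  (H A : V) [BimonObj H] [MonObj A] [RightComodObj H A] [IsRightComoduleAlgebra H A]

theorem isHopfGalois_iff_forall : IsHopfGalois H A ↔ ∀ N, IsIso (canMod H A N) := by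
  rw [IsHopfGalois, ← canMod_regular]
  refine ⟨fun h => ?_, fun h => h _⟩
  have : IsIso (canMod H A (regularMod A)) := h
  exact isIso_canMod H A

variable [∀ X : V, PreservesColimitsOfShape WalkingParallelPair (tensorRight X)]

/-- Keeping P variable lets the equality of the relative Hopf and entwined conditions be
substituted, with no transport between full subcategories. -/
theorem lift_inducedModComod_isEquivalence_iff {P : ObjectProperty (ModComod A H)}
    (hP : P = isEntwinedModule H A (comoduleAlgebraEntwining H A))
    (lands : ∀ M, P ((inducedModComod H A).obj M)) :
    (P.lift (inducedModComod H A) lands).IsEquivalence ↔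
      Nonempty (ComonadicLeftAdjoint (extensionOfScalars (coinvariants.ι H A))) ∧
        IsHopfGalois H A := by
  subst hP
  -- Forgetting the coaction of the induced module gives extension of scalars definitionally.
  let adj : ObjectProperty.lift _ (inducedModComod H A) lands ⋙ forgetCoaction _ ⊣
    restrictionOfScalars (coinvariants.ι H A) := restrictionAdj (coinvariants.ι H A)
  have := (isEntwining H A).comparison_isEquivalence
  rw [isEquivalence_iff_comparison adj (isEntwining H A).cofreeAdj, isHopfGalois_iff_forall]
  refine and_congr (nonempty_comonadicLeftAdjoint_iff adj).symm (forall_congr' fun N => ?_)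
  rw [← isIso_hom_hom_iff]
  -- The mate is the unit of U ⊣ G, here the coaction on N ⊗_B A, followed by the counit N ⊗_B A ⟶ N
  -- tensored with H, which is how `canMod` is defined.
  have h : (mate adj (isEntwining H A).cofreeAdj N).hom.hom = canMod H A N := by
    rw [mate, Adjunction.homEquiv_unit]
    rfl
  rw [h]
  rfl

end Main

end HopfGalois

theorem theorem5p15 {V : Type u} [Category.{v} V] [MonoidalCategory V] [BraidedCategory V]
    [HasEqualizers V] [HasCoequalizers V]
    [∀ X : V, PreservesColimitsOfShape WalkingParallelPair (tensorLeft X)]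
    [∀ X : V, PreservesColimitsOfShape WalkingParallelPair (tensorRight X)]
    (H A : V) [BimonObj H] [MonObj A] [HopfGalois.RightComodObj H A]
    [HopfGalois.IsRightComoduleAlgebra H A] :
    HopfGalois.IsEntwining H A (HopfGalois.comoduleAlgebraEntwining H A) ∧
    HopfGalois.isRelativeHopfModule H A =
      HopfGalois.isEntwinedModule H A (HopfGalois.comoduleAlgebraEntwining H A) ∧
    ∃ lands : ∀ M : HopfGalois.RightMod (HopfGalois.coinvariants H A),
        HopfGalois.isRelativeHopfModule H A ((HopfGalois.inducedModComod H A).obj M),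
      ((HopfGalois.isRelativeHopfModule H A).lift
          (HopfGalois.inducedModComod H A) lands).IsEquivalence ↔
        Nonempty (ComonadicLeftAdjoint
          (HopfGalois.extensionOfScalars (HopfGalois.coinvariants.ι H A))) ∧
        HopfGalois.IsHopfGalois H A := by
  refine ⟨HopfGalois.isEntwining H A, HopfGalois.isRelativeHopfModule_eq H A, ?_, ?_⟩
  · rw [HopfGalois.isRelativeHopfModule_eq]
    exact HopfGalois.inducedModComod_isEntwinedModule H A
  · exact HopfGalois.lift_inducedModComod_isEquivalence_iff H A
      (HopfGalois.isRelativeHopfModule_eq H A) _
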